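/- **Notation.** Write $[n]=\{1,\dots,n\}$ for $n\ge 1$. A symmetric operad (in sets, without operations of arity $0$) is a family of sets $P(n)$, $n\ge1$, with a unit in $P(1)$, partial compositions $\circ_i : P(m)\times P(n)\to P(m+n-1)$ for $1\le i\le m$, and actions of the symmetric groups $S_n$ on $P(n)$, satisfying the usual unit, associativity and equivariance axioms. For $\circ_i$ on $P(m)\times P(n)$, the labels of the first argument that are greater than $i$ are shifted by $n-1$, and the labels of the second argument are shifted by $i-1$. **Trees.** For $n\ge1$, $\mathrm{BWTSL}(n)$ is the set of rooted trees, without order on the children, whose nodes carry pairwise disjoint (possibly empty) sets of labels with union $[n]$, such that every node without labels has at least two children. A node is *red* if it has no label and none of its children is red (recursively); every other node is *white*. The group $S_n$ acts by relabelling, and the unit is the one-node tree labelled $1$. After the shift of labels described above, $T_1\circ_x T_2$ is obtained as follows, where $z$ is the node of $T_1$ that contains $x$: - (W) if the root of $T_2$ is not red, erase $x$ in $z$, add the labels of the root of $T_2$ to $z$, and make the children of the root of $T_2$ new children of $z$; - (R1) if the root of $T_2$ is red and $T_1$ is the one-node tree labelled $x$, the result is $T_2$; - (R2) if the root of $T_2$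 is red and $z$ is not a leaf or has at least two labels, erase $x$ in $z$ and glue the root of $T_2$ as a new child of $z$; - (R3) otherwise $z$ is a leaf, is not the root, and has $x$ as its only label: remove $z$ and make all children of the root of $T_2$ new children of the parent of $z$. **Fractions.** $\mathrm{FF}^\Sigma(n)$ is the set of simplified formal fractions in symbols $[S]$, for $\emptyset\ne S\subseteq[n]$ (that is, the free abelian group on these symbols, written multiplicatively); $S_n$ acts by permuting the elements of $[n]$, and the unit is $1/[1]$. Put $S_{i,n}=\{i,i+1,\dots,i+n-1\}$. For $F\in\mathrm{FF}^\Sigma(m)$ and $G\in\mathrm{FF}^\Sigma(n)$, $$F\circ_i G=[S_{i,n}]\,F(1,\dots,i-1,S_{i,n},i+n,\dots,m+n-1)\,G(i,\dots,i+n-1),$$ where $F(a_1,\dots,a_m)$ is obtained from $F$ by replacing each $k$ by the element or set $a_k$ in every symbol (and taking unions). **The map $\Phi$.** For $T\in\mathrm{BWTSL}(n)$ and a node $z$ of $T$, let $S(z)$ be the set of all labels in the sub-tree with root $z$. Put $\Phi(T)=\prod_z E(z)$, the product over all nodes $z$ of $T$, where $E(z)=1/[S(z)]$ if $z$ is white,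 $E(z)=[S(z)]$ if $z$ is red and not the root, and $E(z)=1$ if $z$ is red and the root. **Theorem.** With these structures, $\mathrm{BWTSL}$ and $\mathrm{FF}^\Sigma$ are symmetric operads, and $\Phi$ is an isomorphism of symmetric operads from $\mathrm{BWTSL}$ onto the symmetric sub-operad of $\mathrm{FF}^\Sigma$ generated by the three fractions $$\frac1{[1][12]},\qquad \frac1{[12]},\qquad \frac1{[1][2]}\qquad\text{in } \mathrm{FF}^\Sigma(2).$$ -/

import Mathlib

/-! ## Symmetric set-operads

Operads have no operation of arity `0`.  Throughout, index `k` stands for arity `k + 1`, and the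
inputs `1, …, k + 1` of an operation of that arity are the elements of `Fin (k + 1)`.  Composing
arities `m = k + 1` and `n = l + 1` gives arity `m + n - 1 = (k + l) + 1`. -/

/-- Renumbering of the inputs of the outer operation in `∘_i`: inputs after `i` are shifted by
`n - 1 = l`, where `n = l + 1` is the arity of the inner operation. -/
def keepIx {k : ℕ} (l : ℕ) (i j : Fin (k + 1)) : Fin (k + l + 1) :=
  ⟨if j ≤ i then (j : ℕ) else (j : ℕ) + l, by split_ifs <;> omega⟩

/-- Renumbering of the inputs of the inner operation in `∘_i`: they become the consecutive inputs
starting at `i`. -/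
def insIx {k l : ℕ} (i : Fin (k + 1)) (j : Fin (l + 1)) : Fin (k + l + 1) :=
  ⟨(i : ℕ) + (j : ℕ), by omega⟩

theorem keepIx_val {k : ℕ} (l : ℕ) (i j : Fin (k + 1)) :
    (keepIx l i j : ℕ) = if (j : ℕ) ≤ i then (j : ℕ) else (j : ℕ) + l := rfl

theorem insIx_val {k l : ℕ} (i : Fin (k + 1)) (j : Fin (l + 1)) :
    (insIx i j : ℕ) = (i : ℕ) + (j : ℕ) := rfl

theorem keepIx_injective {k : ℕ} (l : ℕ) (i : Fin (k + 1)) :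
    Function.Injective (keepIx l i) := by
  intro a b h
  have h' := congrArg Fin.val h
  rw [keepIx_val, keepIx_val] at h'
  apply Fin.ext
  split_ifs at h' <;> omega

theorem insIx_injective {k l : ℕ} (i : Fin (k + 1)) :
    Function.Injective (insIx (l := l) i) := by
  intro a b h
  have h' := congrArg Fin.val h
  rw [insIx_val, insIx_val] at h'
  apply Fin.ext
  omega

theorem keepIx_ne_insIx {k l : ℕ} (i j : Fin (k + 1)) (hj : j ≠ i) (t : Fin (l + 1)) :
    keepIx l i j ≠ insIx i t := by
  intro h
  have h' := congrArg Fin.val h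
  rw [keepIx_val, insIx_val] at h'
  have : (j : ℕ) ≠ i := fun e => hj (Fin.ext e)
  split_ifs at h' <;> omega

theorem keepIx_or_insIx {k l : ℕ} (i : Fin (k + 1)) (y : Fin (k + l + 1)) :
    (∃ j, j ≠ i ∧ keepIx l i j = y) ∨ ∃ t : Fin (l + 1), insIx i t = y := by
  rcases lt_or_ge (y : ℕ) (i : ℕ) with h | h
  · refine Or.inl ⟨⟨y, by omega⟩, fun e => ?_, Fin.ext ?_⟩
    · have := congrArg Fin.val e
      simp only at this
      omega
    · rw [keepIx_val, if_pos (by simp only; omega)]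
  · rcases le_or_gt (y : ℕ) (i + l) with h2 | h2
    · exact Or.inr ⟨⟨y - i, by omega⟩, Fin.ext (by rw [insIx_val]; simp only; omega)⟩
    · refine Or.inl ⟨⟨y - l, by omega⟩, fun e => ?_, Fin.ext ?_⟩
      · have := congrArg Fin.val e
        simp only at this
        omega
      · rw [keepIx_val, if_neg (by simp only; omega)]
        simp only
        omega

/-- The inputs of `A ∘_i B` are the inputs of `A` other than `i`, together with those of `B`. -/
noncomputable def splitIx (k l : ℕ) (i : Fin (k + 1)) :
    {j : Fin (k + 1) // j ≠ i} ⊕ Fin (l + 1) ≃ Fin (k + l + 1) :=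
  Equiv.ofBijective (Sum.elim (fun j => keepIx l i j.1) (fun t => insIx i t)) (by
    constructor
    · rintro (⟨a, ha⟩ | a) (⟨b, hb⟩ | b) h
      · simpa using keepIx_injective l i h
      · exact absurd h (keepIx_ne_insIx i a ha b)
      · exact absurd h.symm (keepIx_ne_insIx i b hb a)
      · simpa using insIx_injective i h
    · intro y
      rcases keepIx_or_insIx i y with ⟨j, hj, rfl⟩ | ⟨t, rfl⟩
      · exact ⟨Sum.inl ⟨j, hj⟩, rfl⟩
      · exact ⟨Sum.inr t, rfl⟩)

/-- The permutation `σ ∘_i τ`: it acts as `τ` inside the block substituted for the input `i`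
and as `σ` on the other inputs and on the position of the block. -/
noncomputable def blockPerm {k l : ℕ} (σ : Equiv.Perm (Fin (k + 1))) (i : Fin (k + 1))
    (τ : Equiv.Perm (Fin (l + 1))) : Equiv.Perm (Fin (k + l + 1)) :=
  (splitIx k l i).symm.trans
    ((Equiv.sumCongr
        (σ.subtypeEquiv (p := fun j => j ≠ i) (q := fun j => j ≠ σ i)
          (fun _ => (σ.injective.ne_iff).symm)) τ).trans
      (splitIx k l (σ i)))

/-- The data of a symmetric set-operad: sets `P k` of operations of arity `k + 1`, a unit,
partial compositions `∘_i`, and the relabelling of inputs by permutations. -/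
structure SymmOperadData where
  P : ℕ → Type
  one : P 0
  comp : ∀ {k l : ℕ}, P k → Fin (k + 1) → P l → P (k + l)
  act : ∀ {k : ℕ}, Equiv.Perm (Fin (k + 1)) → P k → P k

/-- The axioms of a symmetric set-operad.  `HEq` only bridges the equal arities
`k + l + p = k + (l + p)`, `k + l + p = k + p + l` and `0 + k = k`. -/
structure IsSymmOperad (O : SymmOperadData) : Prop where
  assoc : ∀ {k l p : ℕ} (A : O.P k) (B : O.P l) (C : O.P p) (i : Fin (k + 1)) (j : Fin (l + 1)),
    HEq (O.comp (O.comp A i B) (insIx i j) C) (O.comp A i (O.comp B j C))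
  comm : ∀ {k l p : ℕ} (A : O.P k) (B : O.P l) (C : O.P p) (i j : Fin (k + 1)), i ≠ j →
    HEq (O.comp (O.comp A i B) (keepIx l i j) C) (O.comp (O.comp A j C) (keepIx p j i) B)
  one_comp : ∀ {k : ℕ} (A : O.P k), HEq (O.comp O.one 0 A) A
  comp_one : ∀ {k : ℕ} (A : O.P k) (i : Fin (k + 1)), O.comp A i O.one = A
  act_one : ∀ {k : ℕ} (A : O.P k), O.act 1 A = A
  act_mul : ∀ {k : ℕ} (σ τ : Equiv.Perm (Fin (k + 1))) (A : O.P k),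
    O.act (σ * τ) A = O.act σ (O.act τ A)
  comp_act : ∀ {k l : ℕ} (σ : Equiv.Perm (Fin (k + 1))) (τ : Equiv.Perm (Fin (l + 1)))
    (A : O.P k) (B : O.P l) (i : Fin (k + 1)),
    O.comp (O.act σ A) (σ i) (O.act τ B) = O.act (blockPerm σ i τ) (O.comp A i B)

/-- The operations obtained from the family `G` by the unit, the compositions and the actions of
the symmetric groups. -/
inductive SymmOperadData.Gen (O : SymmOperadData) (G : ∀ k, Set (O.P k)) : ∀ k, O.P k → Prop
  | basic {k : ℕ} (A : O.P k) (h : A ∈ G k) : Gen O G k A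
  | one : Gen O G 0 O.one
  | comp {k l : ℕ} (A : O.P k) (i : Fin (k + 1)) (B : O.P l) (hA : Gen O G k A)
      (hB : Gen O G l B) : Gen O G (k + l) (O.comp A i B)
  | act {k : ℕ} (σ : Equiv.Perm (Fin (k + 1))) (A : O.P k) (hA : Gen O G k A) :
      Gen O G k (O.act σ A)

/-- The symmetric sub-operad of `O` generated by the family `G`. -/
def SymmOperadData.generatedBy (O : SymmOperadData) (G : ∀ k, Set (O.P k)) : SymmOperadData where
  P k := {A : O.P k // O.Gen G k A}
  one := ⟨O.one, .one⟩
  comp A i B := ⟨O.comp A.1 i B.1, .comp A.1 i B.1 A.2 B.2⟩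
  act σ A := ⟨O.act σ A.1, .act σ A.1 A.2⟩

/-- An isomorphism of symmetric operads: bijections in each arity that preserve the unit, the
compositions and the actions of the symmetric groups. -/
structure SymmOperadIso (O Q : SymmOperadData) where
  equiv : ∀ k, O.P k ≃ Q.P k
  map_one : equiv 0 O.one = Q.one
  map_comp : ∀ {k l : ℕ} (A : O.P k) (i : Fin (k + 1)) (B : O.P l),
    equiv (k + l) (O.comp A i B) = Q.comp (equiv k A) i (equiv l B)
  map_act : ∀ {k : ℕ} (σ : Equiv.Perm (Fin (k + 1))) (A : O.P k),
    equiv k (O.act σ A) = Q.act σ (equiv k A)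

/-! ## Formal fractions -/

/-- The symbols `[S]`: nonempty finite subsets of `α`. -/
abbrev FSymbol (α : Type) : Type := {S : Finset α // S.Nonempty}

/-- Formal fractions in the symbols `[S]`, that is, the free abelian group on the symbols, written
multiplicatively. -/
abbrev FormalFraction (α : Type) : Type := Multiplicative (FSymbol α →₀ ℤ)

/-- The fraction `[S]`. -/
noncomputable def symb {α : Type} (S : FSymbol α) : FormalFraction α :=
  Multiplicative.ofAdd (Finsupp.single S 1)

/-- The symbol `{a}`. -/
def FSymbol.singleton {α : Type} (a : α) : FSymbol α := ⟨{a}, Finset.singleton_nonempty a⟩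

/-- Replace each element `a` of `S` by the set `f a`, and take the union. -/
def FSymbol.subst {α β : Type} [DecidableEq β] (f : α → FSymbol β) (S : FSymbol α) : FSymbol β :=
  ⟨S.1.biUnion fun a => (f a).1, S.2.biUnion fun a _ => (f a).2⟩

/-- `F(f 1, …, f n)`: each `a` is replaced by the set `f a` in all symbols of the fraction `F`. -/
noncomputable def FormalFraction.subst {α β : Type} [DecidableEq β] (f : α → FSymbol β) :
    FormalFraction α →* FormalFraction β :=
  AddMonoidHom.toMultiplicative (Finsupp.mapDomain.addMonoidHom (FSymbol.subst f))

/-- The block `{i, i + 1, …, i + n - 1}`, `n = l + 1`. -/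
def blockIx {k : ℕ} (l : ℕ) (i : Fin (k + 1)) : FSymbol (Fin (k + l + 1)) :=
  ⟨Finset.univ.image (insIx (l := l) i), Finset.univ_nonempty.image _⟩

/-- The symmetric operad of formal fractions. -/
noncomputable def FFOperad : SymmOperadData where
  P k := FormalFraction (Fin (k + 1))
  one := (symb (FSymbol.singleton 0))⁻¹
  comp {_ l} F i G :=
    symb (blockIx l i) *
      FormalFraction.subst
        (fun j => if j = i then blockIx l i else FSymbol.singleton (keepIx l i j)) F *
      FormalFraction.subst (fun t => FSymbol.singleton (insIx i t)) G
  act σ F := FormalFraction.subst (fun j => FSymbol.singleton (σ j)) F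

/-- The three fractions `1/([1][12])`, `1/[12]` and `1/([1][2])`, all of arity two. -/
noncomputable def ffGenerators : ∀ k, Set (FFOperad.P k)
  | 1 =>
    let s1 : FSymbol (Fin 2) := ⟨{0}, by simp⟩
    let s2 : FSymbol (Fin 2) := ⟨{1}, by simp⟩
    let s12 : FSymbol (Fin 2) := ⟨{0, 1}, by simp⟩
    ({(symb s1 * symb s12)⁻¹, (symb s12)⁻¹, (symb s1 * symb s2)⁻¹} :
      Set (FormalFraction (Fin 2)))
  | _ => ∅

/-! ## Rooted trees without order on the children

The nodes carry finite sets of labels.  The type is the initial algebra of the functor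
`X ↦ Finset α × Multiset X`: a tree is a finite set of labels (those of the root) together with a
finite multiset of trees (the children of the root). -/

/-- A set of labels together with a multiset of children. -/
def NodeShape (α X : Type) : Type := Finset α × Multiset X

noncomputable instance instQPFNodeShape (α : Type) : QPF (NodeShape α) where
  map f p := (p.1, p.2.map f)
  P := ⟨Finset α × ℕ, fun a => Fin a.2⟩
  abs p := (p.1.1, Multiset.ofList (List.ofFn p.2))
  repr x := ⟨(x.1, (Quot.out x.2).length), (Quot.out x.2).get⟩
  abs_repr := by
    rintro β ⟨L, C⟩
    refine Prod.ext rfl ?_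
    change Multiset.ofList (List.ofFn (Quot.out C).get) = C
    rw [List.ofFn_get]
    exact Quot.out_eq C
  abs_map := by
    rintro β γ f ⟨a, c⟩
    refine Prod.ext rfl ?_
    change Multiset.ofList (List.ofFn (f ∘ c)) = (Multiset.ofList (List.ofFn c)).map f
    rw [Multiset.map_coe, List.map_ofFn]

/-- Finite rooted trees, with no order on the children, whose nodes carry finite sets of
labels from `α`. -/
def LTree (α : Type) : Type := QPF.Fix (NodeShape α)

namespace LTree

variable {α β : Type}

/-- The tree whose root has the set of labels `L` and the children (sub-trees) `C`. -/
noncomputable def node (L : Finset α) (C : Multiset (LTree α)) : LTree α :=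
  QPF.Fix.mk (F := NodeShape α) (L, C)

/-- The labels of the root. -/
noncomputable def rootLabels (T : LTree α) : Finset α := (QPF.Fix.dest (F := NodeShape α) T).1

/-- The sub-trees rooted at the children of the root. -/
noncomputable def children (T : LTree α) : Multiset (LTree α) := (QPF.Fix.dest (F := NodeShape α) T).2

@[simp] theorem rootLabels_node (L : Finset α) (C : Multiset (LTree α)) :
    (node L C).rootLabels = L := by
  exact congrArg Prod.fst (QPF.Fix.dest_mk (F := NodeShape α) (L, C))

@[simp] theorem children_node (L : Finset α) (C : Multiset (LTree α)) :
    (node L C).children = C := by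
  exact congrArg Prod.snd (QPF.Fix.dest_mk (F := NodeShape α) (L, C))

theorem node_eta (T : LTree α) : node T.rootLabels T.children = T :=
  QPF.Fix.mk_dest (F := NodeShape α) T

theorem ind {p : LTree α → Prop} (h : ∀ L C, (∀ t ∈ C, p t) → p (node L C)) (T : LTree α) :
    p T := by
  refine QPF.Fix.ind (F := NodeShape α) p ?_ T
  rintro ⟨L, C⟩ hx
  refine h L C fun t ht => ?_
  obtain ⟨a, f, hxy, hf⟩ := (QPF.liftp_iff (F := NodeShape α) _ _).1 hx
  have hC : C = Multiset.ofList (List.ofFn f) := congrArg Prod.snd hxy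
  subst hC
  obtain ⟨i, hi⟩ := (List.mem_ofFn (f := f)).1 (Multiset.mem_coe.1 ht)
  exact hi ▸ hf i

/-- Structural recursion over a tree. -/
noncomputable def fold (g : Finset α → Multiset β → β) : LTree α → β :=
  QPF.Fix.rec (F := NodeShape α) fun p => g p.1 p.2

theorem fold_node (g : Finset α → Multiset β → β) (L : Finset α) (C : Multiset (LTree α)) :
    fold g (node L C) = g L (C.map (fold g)) :=
  QPF.Fix.rec_eq (F := NodeShape α) _ _

/-- Structural recursion that also has access to the children themselves. -/
noncomputable def para (g : Finset α → Multiset (LTree α × β) → β) (T : LTree α) : β :=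
  (fold (fun L M => ((node L (M.map Prod.fst), g L M) : LTree α × β)) T).2

theorem para_node (g : Finset α → Multiset (LTree α × β) → β) (L : Finset α)
    (C : Multiset (LTree α)) :
    para g (node L C) = g L (C.map fun t => (t, para g t)) := by
  have key : ∀ T : LTree α,
      (fold (fun L M => ((node L (M.map Prod.fst), g L M) : LTree α × β)) T).1 = T := by
    refine ind fun L C ih => ?_
    rw [fold_node]
    simp only [Multiset.map_map, Function.comp_def]
    rw [Multiset.map_congr rfl ih, Multiset.map_id']
  unfold para
  rw [fold_node]
  simp only
  congr 1
  exact Multiset.map_congr rfl fun t _ => Prod.ext (key t) rfl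

/-- The multiset of all labels occurring in the tree. -/
noncomputable def labels (T : LTree α) : Multiset α := fold (fun L M => L.val + M.sum) T

/-- The root of `T` is red if it is empty and all its children are white.  (Nodes that
are not red are white.) -/
noncomputable def IsRed (T : LTree α) : Prop := fold (fun L M => L = ∅ ∧ ∀ r ∈ M, ¬ r) T

/-- Every node without labels has at least two children. -/
noncomputable def IsRW (T : LTree α) : Prop := fold (fun L M => (L = ∅ → 2 ≤ M.card) ∧ ∀ w ∈ M, w) T

/-- The multiset of all nodes of the tree, each node being given as the sub-tree rooted at it. -/
noncomputable def nodes (T : LTree α) : Multiset (LTree α) :=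
  para (fun L M => node L (M.map Prod.fst) ::ₘ (M.map Prod.snd).sum) T

/-- Apply `f` to all labels. -/
noncomputable def relabel [DecidableEq β] (f : α → β) (T : LTree α) : LTree β :=
  fold (fun L M => node (L.image f) M) T

/-- The tree with a single node, labelled by `x` only. -/
noncomputable def leaf (x : α) : LTree α := node {x} 0

theorem labels_node (L : Finset α) (C : Multiset (LTree α)) :
    labels (node L C) = L.val + (C.map labels).sum := fold_node _ _ _

theorem isRed_node (L : Finset α) (C : Multiset (LTree α)) :
    IsRed (node L C) ↔ L = ∅ ∧ ∀ t ∈ C, ¬ IsRed t := by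
  unfold IsRed
  rw [fold_node]
  simp only [Multiset.forall_mem_map_iff]

theorem isRW_node (L : Finset α) (C : Multiset (LTree α)) :
    IsRW (node L C) ↔ (L = ∅ → 2 ≤ C.card) ∧ ∀ t ∈ C, IsRW t := by
  unfold IsRW
  rw [fold_node]
  simp only [Multiset.forall_mem_map_iff, Multiset.card_map]

theorem nodes_node (L : Finset α) (C : Multiset (LTree α)) :
    nodes (node L C) = node L C ::ₘ (C.map nodes).sum := by
  unfold nodes
  rw [para_node]
  simp only [Multiset.map_map, Function.comp_def, Multiset.map_id']

theorem relabel_node [DecidableEq β] (f : α → β) (L : Finset α) (C : Multiset (LTree α)) :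
    relabel f (node L C) = node (L.image f) (C.map (relabel f)) := fold_node _ _ _

theorem labels_relabel [DecidableEq β] {f : α → β} (hf : Function.Injective f) (T : LTree α) :
    labels (relabel f T) = (labels T).map f := by
  revert T
  refine ind fun L C ih => ?_
  rw [relabel_node, labels_node, labels_node, Multiset.map_add, Finset.image_val,
    Multiset.Nodup.dedup (L.nodup.map hf), Multiset.map_map]
  congr 1
  refine Eq.trans ?_ (map_multiset_sum (Multiset.mapAddMonoidHom f) (C.map labels)).symm
  rw [Multiset.map_map]
  refine congrArg Multiset.sum ?_
  exact Multiset.map_congr rfl ih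

theorem isRW_relabel [DecidableEq β] (f : α → β) (T : LTree α) (h : IsRW T) :
    IsRW (relabel f T) := by
  revert T
  refine ind fun L C ih h => ?_
  rw [isRW_node] at h
  rw [relabel_node, isRW_node]
  refine ⟨fun h0 => ?_, fun t ht => ?_⟩
  · rw [Multiset.card_map]
    exact h.1 (Finset.image_eq_empty.1 h0)
  · obtain ⟨s, hs, rfl⟩ := Multiset.mem_map.1 ht
    exact ih s hs (h.2 s hs)

theorem mem_labels_node {x : α} {L : Finset α} {C : Multiset (LTree α)} :
    x ∈ labels (node L C) ↔ x ∈ L ∨ ∃ t ∈ C, x ∈ labels t := by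
  rw [labels_node, Multiset.mem_add, Finset.mem_val, ← Multiset.join, Multiset.mem_join]
  simp

theorem labels_leaf (x : α) : labels (leaf x) = {x} := by
  rw [leaf, labels_node]
  simp

theorem rootLabels_of_isRed {U : LTree α} (h : U.IsRed) : U.rootLabels = ∅ := by
  rw [← node_eta U, isRed_node] at h
  exact h.1

/-- Splitting off the child that contains a given label. -/
theorem exists_child {x : α} {L : Finset α} {C : Multiset (LTree α)}
    (hnd : (labels (node L C)).Nodup) (hx : x ∈ labels (node L C)) (hL : x ∉ L) :
    ∃ c D, C = c ::ₘ D ∧ x ∈ labels c ∧ (labels c).Nodup ∧ ∀ t ∈ D, x ∉ labels t := by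
  obtain ⟨c, hc, hxc⟩ := (mem_labels_node.1 hx).resolve_left hL
  obtain ⟨D, rfl⟩ := Multiset.exists_cons_of_mem hc
  rw [labels_node, Multiset.map_cons, Multiset.sum_cons, Multiset.nodup_add, Multiset.nodup_add]
    at hnd
  refine ⟨c, D, rfl, hxc, hnd.2.1.1, fun t ht hxt => ?_⟩
  refine Multiset.disjoint_left.1 hnd.2.1.2.2 hxc ?_
  rw [← Multiset.join, Multiset.mem_join]
  exact ⟨_, Multiset.mem_map_of_mem _ ht, hxt⟩

section Graft

variable [DecidableEq α]

/-- Rule (W): erase `x` from its node `z`, add the labels of the root of `U` to `z` and put the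
children of the root of `U` as new children of `z`. -/
noncomputable def graftWhite (x : α) (U : LTree α) : LTree α → LTree α :=
  para fun L M =>
    if x ∈ L then node (L.erase x ∪ U.rootLabels) (M.map Prod.fst + U.children)
    else node L (M.map Prod.snd)

open Classical in
/-- Rules (R2) and (R3).  If the label `x` is that of a leaf labelled by `x` only, remove this leaf
and put the children of the root of `U` as new children of its parent.  Otherwise, erase `x` from
its node and glue the root of `U` as a new child of this node. -/
noncomputable def graftRed (x : α) (U : LTree α) : LTree α → LTree α :=
  para fun L M =>
    if x ∈ L then node (L.erase x) (U ::ₘ M.map Prod.fst)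
    else if leaf x ∈ M.map Prod.fst then
      node L ((M.map Prod.fst).erase (leaf x) + U.children)
    else node L (M.map Prod.snd)

open Classical in
/-- Substitution of `U` for the label `x`; the second case is rule (R1). -/
noncomputable def graft (T : LTree α) (x : α) (U : LTree α) : LTree α :=
  if ¬ U.IsRed then graftWhite x U T
  else if T = leaf x then U
  else graftRed x U T

theorem graftWhite_node (x : α) (U : LTree α) (L : Finset α) (C : Multiset (LTree α)) :
    graftWhite x U (node L C) =
      if x ∈ L then node (L.erase x ∪ U.rootLabels) (C + U.children)
      else node L (C.map (graftWhite x U)) := by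
  unfold graftWhite
  rw [para_node]
  simp only [Multiset.map_map, Function.comp_def, Multiset.map_id']

open Classical in
theorem graftRed_node (x : α) (U : LTree α) (L : Finset α) (C : Multiset (LTree α)) :
    graftRed x U (node L C) =
      if x ∈ L then node (L.erase x) (U ::ₘ C)
      else if leaf x ∈ C then node L (C.erase (leaf x) + U.children)
      else node L (C.map (graftRed x U)) := by
  unfold graftRed
  rw [para_node]
  simp only [Multiset.map_map, Function.comp_def, Multiset.map_id']

theorem graftWhite_of_notMem (x : α) (U T : LTree α) (h : x ∉ labels T) :
    graftWhite x U T = T := by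
  revert T
  refine ind fun L C ih h => ?_
  rw [mem_labels_node, not_or] at h
  rw [graftWhite_node, if_neg h.1]
  rw [Multiset.map_congr rfl fun t ht => ih t ht fun hx => h.2 ⟨t, ht, hx⟩, Multiset.map_id']

theorem graftRed_of_notMem (x : α) (U T : LTree α) (h : x ∉ labels T) :
    graftRed x U T = T := by
  revert T
  refine ind fun L C ih h => ?_
  rw [mem_labels_node, not_or] at h
  rw [graftRed_node, if_neg h.1, if_neg fun hl => h.2 ⟨_, hl, by
    rw [leaf, mem_labels_node]; simp⟩]
  rw [Multiset.map_congr rfl fun t ht => ih t ht fun hx => h.2 ⟨t, ht, hx⟩, Multiset.map_id']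

theorem labels_graftWhite (x : α) (U T : LTree α) (hnd : (labels T).Nodup) (hx : x ∈ labels T)
    (hd : ∀ y ∈ labels T, y ≠ x → y ∉ labels U) :
    labels (graftWhite x U T) = (labels T).erase x + labels U := by
  revert T
  refine ind fun L C ih hnd hx hd => ?_
  rw [graftWhite_node]
  split_ifs with hL
  · rw [← node_eta U] at hd ⊢
    generalize U.rootLabels = LU at *
    generalize U.children = CU at *
    simp only [rootLabels_node, children_node]
    have hdis : Disjoint (L.erase x) LU := by
      rw [Finset.disjoint_left]
      intro y hy hyU
      rw [Finset.mem_erase] at hy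
      exact hd y (mem_labels_node.2 (Or.inl hy.2)) hy.1 (mem_labels_node.2 (Or.inl hyU))
    rw [← Finset.disjUnion_eq_union _ _ hdis, labels_node, labels_node, labels_node,
      Multiset.map_add, Multiset.sum_add, Multiset.erase_add_left_pos _ (show x ∈ L.val from hL),
      ← Finset.erase_val]
    change (L.erase x).val + LU.val + _ = _
    abel
  · obtain ⟨c, D, rfl, hxc, hndc, hD⟩ := exists_child hnd hx hL
    have hcm : c ∈ c ::ₘ D := Multiset.mem_cons_self c D
    have h1 := ih c hcm hndc hxc
      fun y hy hyx => hd y (mem_labels_node.2 (Or.inr ⟨c, hcm, hy⟩)) hyx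
    rw [labels_node, labels_node, Multiset.map_cons, Multiset.map_cons, Multiset.map_cons,
      Multiset.map_congr rfl fun t ht => graftWhite_of_notMem x U t (hD t ht), Multiset.map_id',
      Multiset.sum_cons, Multiset.sum_cons, h1,
      Multiset.erase_add_right_neg _ (fun h => hL h),
      Multiset.erase_add_left_pos _ hxc]
    abel

theorem isRW_graftWhite (x : α) (U T : LTree α) (hU : IsRW U) (hT : IsRW T) :
    IsRW (graftWhite x U T) := by
  revert T
  refine ind fun L C ih hT => ?_
  rw [isRW_node] at hT
  rw [graftWhite_node]
  split_ifs with hL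
  · rw [← node_eta U, isRW_node] at hU
    rw [isRW_node]
    refine ⟨fun h0 => ?_, fun t ht => ?_⟩
    · have := hU.1 (Finset.union_eq_empty.1 h0).2
      rw [Multiset.card_add]
      omega
    · rcases Multiset.mem_add.1 ht with h | h
      · exact hT.2 t h
      · exact hU.2 t h
  · rw [isRW_node, Multiset.card_map]
    refine ⟨hT.1, fun t ht => ?_⟩
    obtain ⟨s, hs, rfl⟩ := Multiset.mem_map.1 ht
    exact ih s hs (hT.2 s hs)

theorem labels_graftRed (x : α) (U T : LTree α) (hU : U.rootLabels = ∅) (hnd : (labels T).Nodup)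
    (hx : x ∈ labels T) :
    labels (graftRed x U T) = (labels T).erase x + labels U := by
  classical
  revert T
  refine ind fun L C ih hnd hx => ?_
  rw [graftRed_node]
  split_ifs with hL hl
  · rw [labels_node, labels_node, Multiset.map_cons, Multiset.sum_cons,
      Multiset.erase_add_left_pos _ (show x ∈ L.val from hL), ← Finset.erase_val]
    abel
  · obtain ⟨D, rfl⟩ := Multiset.exists_cons_of_mem hl
    have hUl : labels U = (U.children.map labels).sum := by
      conv_lhs => rw [← node_eta U, hU, labels_node]
      simp
    rw [labels_node, labels_node, Multiset.erase_cons_head, Multiset.map_add, Multiset.sum_add,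
      Multiset.map_cons, Multiset.sum_cons,
      Multiset.erase_add_right_neg _ (fun h => hL h), labels_leaf,
      Multiset.singleton_add, Multiset.erase_cons_head, hUl]
    abel
  · obtain ⟨c, D, rfl, hxc, hndc, hD⟩ := exists_child hnd hx hL
    have h1 := ih c (Multiset.mem_cons_self c D) hndc hxc
    rw [labels_node, labels_node, Multiset.map_cons, Multiset.map_cons, Multiset.map_cons,
      Multiset.map_congr rfl fun t ht => graftRed_of_notMem x U t (hD t ht), Multiset.map_id',
      Multiset.sum_cons, Multiset.sum_cons, h1,
      Multiset.erase_add_right_neg _ (fun h => hL h),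
      Multiset.erase_add_left_pos _ hxc]
    abel

theorem isRW_graftRed (x : α) (U T : LTree α) (hU : IsRW U) (hU0 : U.rootLabels = ∅)
    (hT : IsRW T) (hne : T ≠ leaf x) : IsRW (graftRed x U T) := by
  classical
  revert T
  refine ind fun L C ih hT hne => ?_
  rw [isRW_node] at hT
  rw [graftRed_node]
  split_ifs with hL hl
  · rw [isRW_node, Multiset.card_cons]
    refine ⟨fun h0 => ?_, fun t ht => ?_⟩
    · have hLx : L = {x} := by
        rw [← Finset.insert_erase hL, h0]
        rfl
      have : C ≠ 0 := by
        rintro rfl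
        exact hne (by rw [hLx, leaf])
      have := Multiset.card_pos.2 this
      omega
    · rcases Multiset.mem_cons.1 ht with rfl | h
      · exact hU
      · exact hT.2 t h
  · rw [← node_eta U, isRW_node] at hU
    obtain ⟨D, rfl⟩ := Multiset.exists_cons_of_mem hl
    rw [Multiset.erase_cons_head, isRW_node, Multiset.card_add]
    have h2 := hU.1 hU0
    refine ⟨fun _ => by omega, fun t ht => ?_⟩
    rcases Multiset.mem_add.1 ht with h | h
    · exact hT.2 t (Multiset.mem_cons_of_mem h)
    · exact hU.2 t h
  · rw [isRW_node, Multiset.card_map]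
    refine ⟨hT.1, fun t ht => ?_⟩
    obtain ⟨s, hs, rfl⟩ := Multiset.mem_map.1 ht
    exact ih s hs (hT.2 s hs) fun h => hl (h ▸ hs)

theorem labels_graft (x : α) (U T : LTree α) (hnd : (labels T).Nodup) (hx : x ∈ labels T)
    (hd : ∀ y ∈ labels T, y ≠ x → y ∉ labels U) :
    labels (graft T x U) = (labels T).erase x + labels U := by
  unfold graft
  split_ifs with h1 h2
  · rw [h2, labels_leaf]
    simp
  · exact labels_graftRed x U T (rootLabels_of_isRed h1) hnd hx
  · exact labels_graftWhite x U T hnd hx hd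

theorem isRW_graft (x : α) (U T : LTree α) (hU : IsRW U) (hT : IsRW T) :
    IsRW (graft T x U) := by
  unfold graft
  split_ifs with h1 h2
  · exact hU
  · exact isRW_graftRed x U T hU (rootLabels_of_isRed h1) hT h2
  · exact isRW_graftWhite x U T hU hT

end Graft

end LTree

/-! ## The operad of labelled red and white trees -/

/-- Labelled red and white trees of weight `k + 1`: each of the integers `1, …, k + 1` labels
exactly one node, and each node without labels has at least two children. -/
def RWTree (k : ℕ) : Type :=
  {T : LTree (Fin (k + 1)) // T.IsRW ∧ T.labels = Finset.univ.val}

/-- The composition `T ∘_i U`: renumber both trees, then substitute `U` for the label `i`. -/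
noncomputable def RWTree.comp {k l : ℕ} (T : RWTree k) (i : Fin (k + 1)) (U : RWTree l) :
    RWTree (k + l) :=
  ⟨(T.1.relabel (keepIx l i)).graft (keepIx l i i) (U.1.relabel (insIx i)), by
    refine ⟨LTree.isRW_graft _ _ _ (LTree.isRW_relabel _ _ U.2.1)
      (LTree.isRW_relabel _ _ T.2.1), ?_⟩
    have hT : (T.1.relabel (keepIx l i)).labels = Finset.univ.val.map (keepIx l i) := by
      rw [LTree.labels_relabel (keepIx_injective l i), T.2.2]
    have hU : (U.1.relabel (insIx (k := k) i)).labels = Finset.univ.val.map (insIx i) := by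
      rw [LTree.labels_relabel (insIx_injective i), U.2.2]
    have hnT : (Finset.univ.val.map (keepIx l i)).Nodup :=
      Finset.univ.nodup.map (keepIx_injective l i)
    have hnU : (Finset.univ.val.map (insIx (l := l) i)).Nodup :=
      Finset.univ.nodup.map (insIx_injective i)
    have hd : ∀ y ∈ Finset.univ.val.map (keepIx l i), y ≠ keepIx l i i →
        y ∉ Finset.univ.val.map (insIx (l := l) i) := by
      intro y hy hne hy'
      obtain ⟨j, -, rfl⟩ := Multiset.mem_map.1 hy
      obtain ⟨t, -, ht⟩ := Multiset.mem_map.1 hy'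
      exact keepIx_ne_insIx i j (fun e => hne (by rw [e])) t ht.symm
    rw [LTree.labels_graft _ _ _ (hT ▸ hnT)
      (by rw [hT]; exact Multiset.mem_map_of_mem _ (Finset.mem_univ_val i))
      (by rw [hT, hU]; exact hd),
      hT, hU]
    refine (Multiset.Nodup.ext ?_ Finset.univ.nodup).2 fun y => ?_
    · refine Multiset.nodup_add.2 ⟨hnT.erase _, hnU, Multiset.disjoint_left.2 fun {y} hy => ?_⟩
      obtain ⟨h1, h2⟩ := (hnT.mem_erase_iff).1 hy
      exact hd y h2 h1
    · refine ⟨fun _ => Finset.mem_univ_val y, fun _ => Multiset.mem_add.2 ?_⟩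
      rcases keepIx_or_insIx i y with ⟨j, hj, rfl⟩ | ⟨t, rfl⟩
      · refine Or.inl ((hnT.mem_erase_iff).2 ⟨fun e => hj (keepIx_injective l i e), ?_⟩)
        exact Multiset.mem_map_of_mem _ (Finset.mem_univ_val j)
      · exact Or.inr (Multiset.mem_map_of_mem _ (Finset.mem_univ_val t))⟩

/-- Relabelling by a permutation. -/
noncomputable def RWTree.act {k : ℕ} (σ : Equiv.Perm (Fin (k + 1))) (T : RWTree k) : RWTree k :=
  ⟨T.1.relabel σ, LTree.isRW_relabel _ _ T.2.1, by
    rw [LTree.labels_relabel σ.injective, T.2.2]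
    exact (Multiset.Nodup.ext (Finset.univ.nodup.map σ.injective) Finset.univ.nodup).2
      fun y => ⟨fun _ => Finset.mem_univ_val y,
        fun _ => Multiset.mem_map.2 ⟨σ.symm y, Finset.mem_univ_val _, by simp⟩⟩⟩

/-- The tree with one node, labelled `1`. -/
noncomputable def RWTree.one : RWTree 0 :=
  ⟨LTree.leaf 0, by rw [LTree.leaf, LTree.isRW_node]; simp, by rw [LTree.labels_leaf]; rfl⟩

/-- The symmetric operad of labelled red and white trees. -/
noncomputable def RWOperad : SymmOperadData where
  P := RWTree
  one := RWTree.one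
  comp := RWTree.comp
  act := RWTree.act

/-! ## From trees to fractions -/

open Classical in
/-- `[S(z)]`, where `S(z)` is the set of all labels in the sub-tree `z`.  In a red and white tree
`S(z)` is never empty, so that the value `1` is not used. -/
noncomputable def LTree.symbol {α : Type} (z : LTree α) : FormalFraction α :=
  if h : z.labels.toFinset.Nonempty then symb ⟨z.labels.toFinset, h⟩ else 1

open Classical in
/-- `Φ(T)` is the product over the nodes `z` of `T` of `1/[S(z)]` if `z` is white, of `[S(z)]` if
`z` is red and not the root, and of `1` if `z` is red and the root. -/
noncomputable def LTree.fraction {α : Type} (T : LTree α) : FormalFraction α :=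
  (if T.IsRed then 1 else T.symbol⁻¹) *
    ((T.children.bind LTree.nodes).map
      fun z => if z.IsRed then z.symbol else z.symbol⁻¹).prod

/-- The map `Φ` from labelled red and white trees to formal fractions. -/
noncomputable def Phi {k : ℕ} (T : RWOperad.P k) : FFOperad.P k := LTree.fraction T.1

/-! ## Substitution in formal fractions -/

/-! Composition of fractions is a substitution of sets for letters, corrected by one symbol, the
block. The operad axioms for fractions therefore reduce to equalities of symbols. A substituted
symbol is a preimage under `collapseIx`, so these equalities become linear arithmetic on positions.

`Φ` respects composition because grafting `U` at `x` replaces `x` by the label set `S` of `U` in the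
sets of the nodes above `x`, and keeps the colour of every surviving node of the outer tree. Only
the root of `U` needs care. Under (W) it is absorbed, and its factor `1/[S]` is cancelled by the
block `[S]` of the composition formula. Under (R2) it becomes an inner red node, and the block is
its factor, which `Φ(U)` omits. Under (R1) and (R3) the block cancels the `1/[S]` that comes from
the leaf `x`. The induction is run on `weight`, which treats the root like any other node;
`fraction_graft` collects the cases.

`Φ` is injective because label sets strictly decrease down the tree and are disjoint on siblings.
Distinct nodes thus have distinct sets, nothing cancels, and the fraction shows the whole nested
family of sets (that of the root is known anyway). The family determines the tree:
`eq_of_isNodeSet_iff`. The operad axioms for trees are then inherited from fractions through `Φ`.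

The generators are the images of trees with two labels, so the image contains the generated
sub-operad. Conversely, inserting fractions `F`, `G` with disjoint inputs `A`, `B` into the
generators gives the products `F G`, `[A][B]/[A ∪ B] F G` and `[A]/[A ∪ B] F G` (`mul`, `mul_node`,
`mul_chain`). The first assembles a red root from its white children; the other two attach a red or
a white child to a white node under construction. That construction starts from `1/[L]`, or from a
red child if the node has no label. -/

theorem FSymbol.mem_subst {α β : Type} [DecidableEq β] {f : α → FSymbol β} {S : FSymbol α}
    {y : β} : y ∈ (FSymbol.subst f S).1 ↔ ∃ a ∈ S.1, y ∈ (f a).1 :=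
  Finset.mem_biUnion

theorem FSymbol.mem_singleton {α : Type} {a y : α} : y ∈ (FSymbol.singleton a).1 ↔ y = a :=
  Finset.mem_singleton

theorem FSymbol.ext_mem {α : Type} {S S' : FSymbol α} (h : ∀ y, y ∈ S.1 ↔ y ∈ S'.1) : S = S' :=
  Subtype.ext (Finset.ext h)

theorem FSymbol.subst_singleton {α β : Type} [DecidableEq β] (f : α → FSymbol β) (a : α) :
    FSymbol.subst f (FSymbol.singleton a) = f a :=
  FSymbol.ext_mem fun y => by simp [FSymbol.mem_subst, FSymbol.mem_singleton]

theorem FSymbol.subst_subst {α β γ : Type} [DecidableEq β] [DecidableEq γ] (f : β → FSymbol γ)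
    (g : α → FSymbol β) (S : FSymbol α) :
    FSymbol.subst f (FSymbol.subst g S) = FSymbol.subst (fun a => FSymbol.subst f (g a)) S :=
  FSymbol.ext_mem fun y => by
    simp only [FSymbol.mem_subst]
    constructor
    · rintro ⟨b, ⟨a, ha, hb⟩, hy⟩
      exact ⟨a, ha, b, hb, hy⟩
    · rintro ⟨a, ha, b, hb, hy⟩
      exact ⟨b, ⟨a, ha, hb⟩, hy⟩

theorem FSymbol.subst_id {α : Type} [DecidableEq α] (S : FSymbol α) :
    FSymbol.subst FSymbol.singleton S = S :=
  FSymbol.ext_mem fun y => by simp [FSymbol.mem_subst, FSymbol.mem_singleton]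

theorem FSymbol.subst_congr {α β : Type} [DecidableEq β] {f g : α → FSymbol β} {S : FSymbol α}
    (h : ∀ a ∈ S.1, f a = g a) : FSymbol.subst f S = FSymbol.subst g S :=
  FSymbol.ext_mem fun y => by
    simp only [FSymbol.mem_subst]
    exact exists_congr fun a => and_congr_right fun ha => by rw [h a ha]

theorem FormalFraction.subst_symb {α β : Type} [DecidableEq β] (f : α → FSymbol β)
    (S : FSymbol α) : FormalFraction.subst f (symb S) = symb (FSymbol.subst f S) :=
  congrArg Multiplicative.ofAdd Finsupp.mapDomain_single

/-- Reduces identities between substitutions to symbols, which generate the group. -/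
theorem FormalFraction.hom_ext {α : Type} {M : Type} [CommMonoid M]
    {φ ψ : FormalFraction α →* M} (h : ∀ S, φ (symb S) = ψ (symb S)) : φ = ψ := by
  have : MonoidHom.toAdditiveRight φ = MonoidHom.toAdditiveRight ψ := by
    refine Finsupp.addHom_ext' fun S => AddMonoidHom.ext_int ?_
    exact congrArg Additive.ofMul (h S)
  exact MonoidHom.toAdditiveRight.injective this

theorem FormalFraction.subst_subst {α β γ : Type} [DecidableEq β] [DecidableEq γ]
    (f : β → FSymbol γ) (g : α → FSymbol β) (F : FormalFraction α) :
    FormalFraction.subst f (FormalFraction.subst g F) =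
      FormalFraction.subst (fun a => FSymbol.subst f (g a)) F := by
  refine DFunLike.congr_fun (f := (FormalFraction.subst f).comp (FormalFraction.subst g))
    (FormalFraction.hom_ext fun S => ?_) F
  rw [MonoidHom.comp_apply]
  simp only [FormalFraction.subst_symb, FSymbol.subst_subst]

theorem FormalFraction.subst_id {α : Type} [DecidableEq α] (F : FormalFraction α) :
    FormalFraction.subst FSymbol.singleton F = F := by
  refine DFunLike.congr_fun (g := MonoidHom.id _) (FormalFraction.hom_ext fun S => ?_) F
  rw [FormalFraction.subst_symb, FSymbol.subst_id]
  rfl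

/-- Trades the heterogeneous equality of an axiom for an ordinary equation over one alphabet: once
the arities are identified, the renaming is the identity. -/
theorem FormalFraction.heq_of_subst_cast {m n : ℕ} (h : m = n) {F : FormalFraction (Fin (m + 1))}
    {G : FormalFraction (Fin (n + 1))}
    (e : FormalFraction.subst (fun j => FSymbol.singleton (Fin.cast (congrArg (· + 1) h) j)) F
      = G) : HEq F G := by
  subst h
  rw [← e]
  exact heq_of_eq (FormalFraction.subst_id F).symm

theorem mem_subst_cast {m n : ℕ} (h : m = n) {S : FSymbol (Fin (m + 1))} {y : Fin (n + 1)} :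
    y ∈ (FSymbol.subst (fun j => FSymbol.singleton (Fin.cast (congrArg (· + 1) h) j)) S).1 ↔
      Fin.cast (congrArg (· + 1) h.symm) y ∈ S.1 := by
  subst h
  exact iff_of_eq (congrArg (fun S : FSymbol _ => y ∈ S.1) (FSymbol.subst_id S))

/-! ## The operad of formal fractions -/

/-- The symbol substituted for the input `j` of the outer fraction in `∘_i`. -/
def slotIx {k : ℕ} (l : ℕ) (i j : Fin (k + 1)) : FSymbol (Fin (k + l + 1)) :=
  if j = i then blockIx l i else FSymbol.singleton (keepIx l i j)

/-- The input of the outer operation in `∘_i` to which an input of the composite belongs. -/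
def collapseIx {k : ℕ} (l : ℕ) (i : Fin (k + 1)) (y : Fin (k + l + 1)) : Fin (k + 1) :=
  ⟨if (y : ℕ) < i then y else if (y : ℕ) ≤ i + l then i else y - l, by split_ifs <;> omega⟩

/-- A disjunction of linear conditions instead of nested conditionals, so that `omega` can use it as
a hypothesis. -/
theorem collapseIx_spec {k : ℕ} (l : ℕ) (i : Fin (k + 1)) (y : Fin (k + l + 1)) :
    ((y : ℕ) < i ∧ (collapseIx l i y : ℕ) = y) ∨
      ((i : ℕ) ≤ y ∧ (y : ℕ) ≤ i + l ∧ (collapseIx l i y : ℕ) = i) ∨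
      ((i : ℕ) + l < y ∧ (collapseIx l i y : ℕ) + l = y) := by
  unfold collapseIx
  simp only
  split_ifs <;> omega

theorem keepIx_spec {k : ℕ} (l : ℕ) (i j : Fin (k + 1)) :
    ((j : ℕ) ≤ i ∧ (keepIx l i j : ℕ) = j) ∨ ((i : ℕ) < j ∧ (keepIx l i j : ℕ) = j + l) := by
  rw [keepIx_val]
  split_ifs <;> omega

theorem mem_blockIx {k l : ℕ} {i : Fin (k + 1)} {y : Fin (k + l + 1)} :
    y ∈ (blockIx l i).1 ↔ (i : ℕ) ≤ y ∧ (y : ℕ) ≤ i + l := by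
  simp only [blockIx, Finset.mem_image, Finset.mem_univ, true_and]
  constructor
  · rintro ⟨t, rfl⟩
    rw [insIx_val]
    omega
  · rintro ⟨h1, h2⟩
    exact ⟨⟨y - i, by omega⟩, Fin.ext (by rw [insIx_val]; simp only; omega)⟩

/-- The slots are the fibres of `collapseIx`. Substitution of slots is therefore a preimage, and
iterated substitutions become composites of collapsing maps. -/
theorem mem_slotIx {k l : ℕ} {i j : Fin (k + 1)} {y : Fin (k + l + 1)} :
    y ∈ (slotIx l i j).1 ↔ collapseIx l i y = j := by
  unfold slotIx
  split_ifs with h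
  · subst h
    rw [mem_blockIx, Fin.ext_iff]
    have := collapseIx_spec l j y
    omega
  · have h' : (j : ℕ) ≠ i := fun e => h (Fin.ext e)
    rw [FSymbol.mem_singleton, Fin.ext_iff, Fin.ext_iff]
    have := collapseIx_spec l i y
    have := keepIx_spec l i j
    omega

theorem mem_subst_slotIx {k l : ℕ} {i : Fin (k + 1)} {S : FSymbol (Fin (k + 1))}
    {y : Fin (k + l + 1)} : y ∈ (FSymbol.subst (slotIx l i) S).1 ↔ collapseIx l i y ∈ S.1 := by
  simp [FSymbol.mem_subst, mem_slotIx]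

/-- The composition `F ∘_i G` of formal fractions. -/
noncomputable def FormalFraction.comp {k l : ℕ} (F : FormalFraction (Fin (k + 1)))
    (i : Fin (k + 1)) (G : FormalFraction (Fin (l + 1))) : FormalFraction (Fin (k + l + 1)) :=
  symb (blockIx l i) * FormalFraction.subst (slotIx l i) F *
    FormalFraction.subst (fun t => FSymbol.singleton (insIx i t)) G

/-- Permutation of the inputs of a formal fraction. -/
noncomputable def FormalFraction.act {k : ℕ} (σ : Equiv.Perm (Fin (k + 1)))
    (F : FormalFraction (Fin (k + 1))) : FormalFraction (Fin (k + 1)) :=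
  FormalFraction.subst (fun j => FSymbol.singleton (σ j)) F

/-! ### Associativity, commutativity and unit laws for fractions -/

theorem FormalFraction.comp_assoc {k l p : ℕ} (A : FormalFraction (Fin (k + 1)))
    (B : FormalFraction (Fin (l + 1))) (C : FormalFraction (Fin (p + 1)))
    (i : Fin (k + 1)) (j : Fin (l + 1)) :
    HEq ((A.comp i B).comp (insIx i j) C) (A.comp i (B.comp j C)) := by
  have hc : k + l + p = k + (l + p) := Nat.add_assoc k l p
  refine FormalFraction.heq_of_subst_cast hc ?_
  simp only [FormalFraction.comp, map_mul, FormalFraction.subst_symb, FormalFraction.subst_subst,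
    FSymbol.subst_singleton]
  -- Both sides have five factors: the blocks of the two compositions and the images of `A`, `B`,
  -- `C`. The five equalities match them: the block of `C`, the block of `B` swollen by `C`, then
  -- the letters of `A`, `B` and `C`.
  have e1 : FSymbol.subst (fun j => FSymbol.singleton (Fin.cast (congrArg (· + 1) hc) j))
      (blockIx p (insIx i j)) =
      FSymbol.subst (fun t => FSymbol.singleton (insIx i t)) (blockIx p j) := by
    refine FSymbol.ext_mem fun y => ?_
    simp only [FSymbol.mem_subst, mem_blockIx, FSymbol.mem_singleton, insIx_val, Fin.ext_iff,
      Fin.val_cast]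
    constructor
    · rintro ⟨a, h, h'⟩
      exact ⟨⟨y - i, by omega⟩, by simp only; omega, by simp only; omega⟩
    · rintro ⟨a, h, h'⟩
      exact ⟨⟨y, by omega⟩, by simp only; omega, rfl⟩
  have e2 : FSymbol.subst (fun j => FSymbol.singleton (Fin.cast (congrArg (· + 1) hc) j))
      (FSymbol.subst (slotIx p (insIx i j)) (blockIx l i)) = blockIx (l + p) i := by
    refine FSymbol.ext_mem fun y => ?_
    rw [mem_subst_cast hc, mem_subst_slotIx, mem_blockIx, mem_blockIx]
    have := collapseIx_spec p (insIx i j) (Fin.cast (congrArg (· + 1) hc.symm) y)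
    simp only [insIx_val, Fin.val_cast] at this
    omega
  have e3 : (fun a => FSymbol.subst (fun j => FSymbol.singleton (Fin.cast (congrArg (· + 1) hc) j))
      (FSymbol.subst (slotIx p (insIx i j)) (slotIx l i a))) = slotIx (l + p) i := by
    funext a
    refine FSymbol.ext_mem fun y => ?_
    rw [mem_subst_cast hc, mem_subst_slotIx, mem_slotIx, mem_slotIx, Fin.ext_iff, Fin.ext_iff]
    have h1 := collapseIx_spec p (insIx i j) (Fin.cast (congrArg (· + 1) hc.symm) y)
    have := collapseIx_spec l i
      (collapseIx p (insIx i j) (Fin.cast (congrArg (· + 1) hc.symm) y))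
    have := collapseIx_spec (l + p) i y
    simp only [insIx_val, Fin.val_cast] at h1
    omega
  have e4 : (fun t => FSymbol.subst (fun j => FSymbol.singleton (Fin.cast (congrArg (· + 1) hc) j))
      (slotIx p (insIx i j) (insIx i t))) =
      fun t => FSymbol.subst (fun t => FSymbol.singleton (insIx i t)) (slotIx p j t) := by
    funext t
    refine FSymbol.ext_mem fun y => ?_
    rw [mem_subst_cast hc, mem_slotIx, FSymbol.mem_subst]
    simp only [mem_slotIx, FSymbol.mem_singleton, Fin.ext_iff, insIx_val]
    have h1 := collapseIx_spec p (insIx i j) (Fin.cast (congrArg (· + 1) hc.symm) y)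
    simp only [insIx_val, Fin.val_cast] at h1
    constructor
    · intro h
      have hy : (y : ℕ) - i < l + p + 1 := by omega
      have := collapseIx_spec p j ⟨y - i, hy⟩
      exact ⟨⟨y - i, hy⟩, by simp only at this; omega, by simp only; omega⟩
    · rintro ⟨b, h, h'⟩
      have := collapseIx_spec p j b
      omega
  have e5 : (fun t : Fin (p + 1) => FSymbol.singleton (Fin.cast (congrArg (· + 1) hc)
      (insIx (insIx i j) t))) = fun t => FSymbol.singleton (insIx i (insIx j t)) := by
    funext t
    congr 1
    apply Fin.ext
    simp only [Fin.val_cast, insIx_val]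
    omega
  rw [e1, e2, e3, e4, e5]
  ac_rfl

theorem FormalFraction.comp_comm {k l p : ℕ} (A : FormalFraction (Fin (k + 1)))
    (B : FormalFraction (Fin (l + 1))) (C : FormalFraction (Fin (p + 1)))
    (i j : Fin (k + 1)) (hij : i ≠ j) :
    HEq ((A.comp i B).comp (keepIx l i j) C) ((A.comp j C).comp (keepIx p j i) B) := by
  have hij' : (i : ℕ) ≠ j := fun e => hij (Fin.ext e)
  have hc : k + l + p = k + p + l := by omega
  refine FormalFraction.heq_of_subst_cast hc ?_
  simp only [FormalFraction.comp, map_mul, FormalFraction.subst_symb, FormalFraction.subst_subst,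
    FSymbol.subst_singleton]
  have k1 := keepIx_spec l i j
  have k2 := keepIx_spec p j i
  have c1 := fun y : Fin (k + p + l + 1) =>
    collapseIx_spec p (keepIx l i j) (Fin.cast (congrArg (· + 1) hc.symm) y)
  have c2 := fun y : Fin (k + p + l + 1) => collapseIx_spec l (keepIx p j i) y
  simp only [Fin.val_cast] at c1
  -- The same matching, now with two disjoint blocks: the block of `C`, the block of `B`, then the
  -- letters of `A`, `B`, `C`.
  have e1 : FSymbol.subst (fun j => FSymbol.singleton (Fin.cast (congrArg (· + 1) hc) j))
      (blockIx p (keepIx l i j)) = FSymbol.subst (slotIx l (keepIx p j i)) (blockIx p j) := by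
    refine FSymbol.ext_mem fun y => ?_
    rw [mem_subst_cast hc, mem_subst_slotIx, mem_blockIx, mem_blockIx, Fin.val_cast]
    specialize c2 y
    omega
  have e2 : FSymbol.subst (fun j => FSymbol.singleton (Fin.cast (congrArg (· + 1) hc) j))
      (FSymbol.subst (slotIx p (keepIx l i j)) (blockIx l i)) = blockIx l (keepIx p j i) := by
    refine FSymbol.ext_mem fun y => ?_
    rw [mem_subst_cast hc, mem_subst_slotIx, mem_blockIx, mem_blockIx]
    specialize c1 y
    omega
  have e3 : (fun a => FSymbol.subst (fun j => FSymbol.singleton (Fin.cast (congrArg (· + 1) hc) j))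
      (FSymbol.subst (slotIx p (keepIx l i j)) (slotIx l i a))) =
      fun a => FSymbol.subst (slotIx l (keepIx p j i)) (slotIx p j a) := by
    funext a
    refine FSymbol.ext_mem fun y => ?_
    rw [mem_subst_cast hc, mem_subst_slotIx, mem_slotIx, mem_subst_slotIx, mem_slotIx, Fin.ext_iff,
      Fin.ext_iff]
    specialize c1 y
    specialize c2 y
    have := collapseIx_spec l i
      (collapseIx p (keepIx l i j) (Fin.cast (congrArg (· + 1) hc.symm) y))
    have := collapseIx_spec p j (collapseIx l (keepIx p j i) y)
    omega
  have e4 : (fun t : Fin (l + 1) => FSymbol.subst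
      (fun j => FSymbol.singleton (Fin.cast (congrArg (· + 1) hc) j))
      (slotIx p (keepIx l i j) (insIx i t))) =
      fun t => FSymbol.singleton (insIx (keepIx p j i) t) := by
    funext t
    refine FSymbol.ext_mem fun y => ?_
    rw [mem_subst_cast hc, mem_slotIx, FSymbol.mem_singleton, Fin.ext_iff, Fin.ext_iff, insIx_val,
      insIx_val]
    specialize c1 y
    omega
  have e5 : (fun t : Fin (p + 1) => FSymbol.singleton (Fin.cast (congrArg (· + 1) hc)
      (insIx (keepIx l i j) t))) = fun t => slotIx l (keepIx p j i) (insIx j t) := by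
    funext t
    refine FSymbol.ext_mem fun y => ?_
    rw [mem_slotIx, FSymbol.mem_singleton, Fin.ext_iff, Fin.ext_iff, Fin.val_cast, insIx_val,
      insIx_val]
    specialize c2 y
    omega
  rw [e1, e2, e3, e4, e5]
  ac_rfl

theorem FormalFraction.one_comp {k : ℕ} (A : FormalFraction (Fin (k + 1))) :
    HEq (FormalFraction.comp (symb (FSymbol.singleton (0 : Fin (0 + 1))))⁻¹ 0 A) A := by
  refine FormalFraction.heq_of_subst_cast (Nat.zero_add k) ?_
  have e1 : slotIx k (0 : Fin (0 + 1)) 0 = blockIx k 0 := if_pos rfl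
  have e2 : (fun t : Fin (k + 1) => FSymbol.singleton (Fin.cast (congrArg (· + 1)
      (Nat.zero_add k)) (insIx (0 : Fin (0 + 1)) t))) = FSymbol.singleton := by
    funext t
    congr 1
    apply Fin.ext
    simp [insIx_val]
  -- The unit `1/[1]` becomes the inverse of the whole block and cancels the correcting factor.
  rw [FormalFraction.comp, map_inv, FormalFraction.subst_symb, FSymbol.subst_singleton, e1,
    mul_inv_cancel, one_mul, FormalFraction.subst_subst]
  simp only [FSymbol.subst_singleton]
  rw [e2, FormalFraction.subst_id]

theorem FormalFraction.comp_one {k : ℕ} (A : FormalFraction (Fin (k + 1))) (i : Fin (k + 1)) :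
    A.comp i (symb (FSymbol.singleton (0 : Fin (0 + 1))))⁻¹ = A := by
  have e1 : (blockIx 0 i : FSymbol (Fin (k + 1))) = FSymbol.singleton i :=
    FSymbol.ext_mem fun y => by
      rw [FSymbol.mem_singleton, Fin.ext_iff]
      have := mem_blockIx (l := 0) (i := i) (y := y)
      refine this.trans ?_
      omega
  have e2 : (slotIx 0 i : Fin (k + 1) → FSymbol (Fin (k + 1))) = FSymbol.singleton := by
    funext j
    refine FSymbol.ext_mem fun y => ?_
    refine (mem_slotIx (l := 0) (y := y)).trans ?_
    rw [FSymbol.mem_singleton, Fin.ext_iff, Fin.ext_iff]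
    have := collapseIx_spec 0 i y
    omega
  have e3 : insIx i (0 : Fin (0 + 1)) = i := Fin.ext (by simp [insIx_val])
  rw [FormalFraction.comp, map_inv, FormalFraction.subst_symb, FSymbol.subst_singleton]
  -- `k + 0 + 1` is `k + 1` by definition; restating the type lets the rewrites match.
  change symb (blockIx 0 i : FSymbol (Fin (k + 1))) * FormalFraction.subst (slotIx 0 i) A * _ = A
  rw [e1, e2, FormalFraction.subst_id, e3, mul_right_comm]
  exact (congrArg (· * A) (mul_inv_cancel _)).trans (one_mul A)

/-! ### Equivariance of the composition of fractions -/

theorem blockPerm_keepIx {k l : ℕ} (σ : Equiv.Perm (Fin (k + 1))) (i : Fin (k + 1))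
    (τ : Equiv.Perm (Fin (l + 1))) {j : Fin (k + 1)} (hj : j ≠ i) :
    blockPerm σ i τ (keepIx l i j) = keepIx l (σ i) (σ j) := by
  have : (splitIx k l i).symm (keepIx l i j) = Sum.inl ⟨j, hj⟩ :=
    (Equiv.symm_apply_eq _).2 rfl
  simp only [blockPerm, Equiv.trans_apply, this]
  rfl

theorem blockPerm_insIx {k l : ℕ} (σ : Equiv.Perm (Fin (k + 1))) (i : Fin (k + 1))
    (τ : Equiv.Perm (Fin (l + 1))) (t : Fin (l + 1)) :
    blockPerm σ i τ (insIx i t) = insIx (σ i) (τ t) := by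
  have : (splitIx k l i).symm (insIx i t) = Sum.inr t :=
    (Equiv.symm_apply_eq _).2 rfl
  simp only [blockPerm, Equiv.trans_apply, this]
  rfl

theorem subst_blockPerm_blockIx {k l : ℕ} (σ : Equiv.Perm (Fin (k + 1))) (i : Fin (k + 1))
    (τ : Equiv.Perm (Fin (l + 1))) :
    FSymbol.subst (fun j => FSymbol.singleton (blockPerm σ i τ j)) (blockIx l i) =
      blockIx l (σ i) := by
  refine FSymbol.ext_mem fun y => ?_
  simp only [FSymbol.mem_subst, FSymbol.mem_singleton, blockIx, Finset.mem_image, Finset.mem_univ,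
    true_and]
  constructor
  · rintro ⟨_, ⟨t, rfl⟩, rfl⟩
    exact ⟨τ t, (blockPerm_insIx σ i τ t).symm⟩
  · rintro ⟨t, rfl⟩
    exact ⟨_, ⟨τ.symm t, rfl⟩, by rw [blockPerm_insIx, Equiv.apply_symm_apply]⟩

theorem FormalFraction.comp_act {k l : ℕ} (σ : Equiv.Perm (Fin (k + 1)))
    (τ : Equiv.Perm (Fin (l + 1))) (A : FormalFraction (Fin (k + 1)))
    (B : FormalFraction (Fin (l + 1))) (i : Fin (k + 1)) :
    (A.act σ).comp (σ i) (B.act τ) = (A.comp i B).act (blockPerm σ i τ) := by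
  simp only [FormalFraction.comp, FormalFraction.act, map_mul, FormalFraction.subst_symb,
    FormalFraction.subst_subst, FSymbol.subst_singleton, subst_blockPerm_blockIx, blockPerm_insIx]
  congr 4
  funext j
  unfold slotIx
  by_cases h : j = i
  · rw [if_pos h, if_pos (congrArg σ h), subst_blockPerm_blockIx]
  · rw [if_neg h, if_neg (σ.injective.ne h), FSymbol.subst_singleton, blockPerm_keepIx σ i τ h]

theorem FormalFraction.act_mul {k : ℕ} (σ τ : Equiv.Perm (Fin (k + 1)))
    (A : FormalFraction (Fin (k + 1))) : A.act (σ * τ) = (A.act τ).act σ := by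
  simp only [FormalFraction.act, FormalFraction.subst_subst, FSymbol.subst_singleton]
  rfl

theorem isSymmOperad_FFOperad : IsSymmOperad FFOperad where
  assoc := FormalFraction.comp_assoc
  comm := FormalFraction.comp_comm
  one_comp := FormalFraction.one_comp
  comp_one := FormalFraction.comp_one
  act_one A := FormalFraction.subst_id A
  act_mul := FormalFraction.act_mul
  comp_act := FormalFraction.comp_act

/-! ## The fraction of a composite tree -/

namespace LTree

variable {α β : Type}

/-- Descending from a node without labels always meets a child, so a label is eventually found.
Hence the default value of `symbol` never occurs in a red and white tree. -/
theorem exists_mem_labels_of_isRW (T : LTree α) (h : T.IsRW) : ∃ x, x ∈ T.labels := by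
  revert T
  refine ind fun L C ih h => ?_
  rw [isRW_node] at h
  rcases L.eq_empty_or_nonempty with h0 | ⟨x, hx⟩
  · obtain ⟨t, ht⟩ := Multiset.card_pos_iff_exists_mem.1 (lt_of_lt_of_le two_pos (h.1 h0))
    obtain ⟨x, hx⟩ := ih t ht (h.2 t ht)
    exact ⟨x, mem_labels_node.2 (Or.inr ⟨t, ht, hx⟩)⟩
  · exact ⟨x, mem_labels_node.2 (Or.inl hx)⟩

theorem nodup_labels_child {L : Finset α} {C : Multiset (LTree α)}
    (hnd : (labels (node L C)).Nodup) {t : LTree α} (ht : t ∈ C) : (labels t).Nodup := by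
  obtain ⟨D, rfl⟩ := Multiset.exists_cons_of_mem ht
  rw [labels_node, Multiset.map_cons, Multiset.sum_cons, Multiset.nodup_add, Multiset.nodup_add]
    at hnd
  exact hnd.2.1.1

theorem notMem_labels_child {L : Finset α} {C : Multiset (LTree α)}
    (hnd : (labels (node L C)).Nodup) {x : α} (hx : x ∈ L) {t : LTree α} (ht : t ∈ C) :
    x ∉ labels t := by
  intro hxt
  rw [labels_node, Multiset.nodup_add] at hnd
  refine Multiset.disjoint_left.1 hnd.2.2 hx ?_
  rw [← Multiset.join, Multiset.mem_join]
  exact ⟨_, Multiset.mem_map_of_mem _ ht, hxt⟩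

theorem symbol_eq {z : LTree α} {S : FSymbol α} (h : ∀ x, x ∈ S.1 ↔ x ∈ z.labels) :
    z.symbol = symb S := by
  classical
  have e : z.labels.toFinset = S.1 := Finset.ext fun x => by rw [Multiset.mem_toFinset, h]
  obtain ⟨S, hS⟩ := S
  simp only at e
  subst e
  unfold symbol
  exact dif_pos _

theorem symbol_eq_one {z : LTree α} (h : ∀ x, x ∉ z.labels) : z.symbol = 1 := by
  classical
  refine dif_neg ?_
  rintro ⟨x, hx⟩
  exact h x (Multiset.mem_toFinset.1 hx)

/-- If there are no labels, both symbols take the default value `1`. This is why no red and white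
hypothesis is needed. -/
theorem subst_symbol [DecidableEq β] {f : α → FSymbol β} {z : LTree α} {w : LTree β}
    (h : ∀ y, y ∈ w.labels ↔ ∃ x ∈ z.labels, y ∈ (f x).1) :
    FormalFraction.subst f z.symbol = w.symbol := by
  classical
  by_cases h0 : ∃ x, x ∈ z.labels
  · obtain ⟨x, hx⟩ := h0
    rw [symbol_eq (z := z) (S := ⟨z.labels.toFinset, x, Multiset.mem_toFinset.2 hx⟩)
      fun _ => Multiset.mem_toFinset, FormalFraction.subst_symb]
    refine (symbol_eq fun y => ?_).symm
    rw [h, FSymbol.mem_subst]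
    simp only [Multiset.mem_toFinset]
  · push Not at h0
    rw [symbol_eq_one h0, map_one, symbol_eq_one]
    intro y hy
    obtain ⟨x, hx, -⟩ := (h y).1 hy
    exact h0 x hx

open Classical in
/-- The factor of a node that is not the root in `Φ`. -/
noncomputable def factor (z : LTree α) : FormalFraction α :=
  if z.IsRed then z.symbol else z.symbol⁻¹

/-- The product of the factors of all nodes, the root included. -/
noncomputable def weight (T : LTree α) : FormalFraction α := (T.nodes.map factor).prod

/-- This recursion is the reason for using `weight` in inductions: every sub-tree enters with the
full factor of its own root, which `fraction` omits at a red root. -/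
theorem weight_node (L : Finset α) (C : Multiset (LTree α)) :
    weight (node L C) = factor (node L C) * (C.map weight).prod := by
  unfold weight
  rw [nodes_node, Multiset.map_cons, Multiset.prod_cons]
  change _ * ((C.bind nodes).map factor).prod = _
  rw [Multiset.map_bind, Multiset.prod_bind]

theorem factor_of_isRed {z : LTree α} (h : z.IsRed) : z.factor = z.symbol := if_pos h

theorem factor_of_not_isRed {z : LTree α} (h : ¬ z.IsRed) : z.factor = z.symbol⁻¹ := if_neg h

theorem not_isRed_of_mem {L : Finset α} {C : Multiset (LTree α)} {x : α} (h : x ∈ L) :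
    ¬ (node L C).IsRed := by
  rw [isRed_node]
  rintro ⟨rfl, -⟩
  exact absurd h (Finset.notMem_empty x)

open Classical in
theorem fraction_eq_prod (T : LTree α) :
    T.fraction = (if T.IsRed then 1 else T.symbol⁻¹) * (T.children.map weight).prod := by
  unfold fraction weight factor
  rw [Multiset.map_bind, Multiset.prod_bind]

theorem weight_of_isRed {T : LTree α} (h : T.IsRed) : T.weight = T.symbol * T.fraction := by
  rw [fraction_eq_prod, if_pos h, one_mul]
  conv_lhs => rw [← node_eta T]
  rw [weight_node, node_eta, factor_of_isRed h]

theorem fraction_of_not_isRed {T : LTree α} (h : ¬ T.IsRed) : T.fraction = T.weight := by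
  rw [fraction_eq_prod, if_neg h]
  conv_rhs => rw [← node_eta T]
  rw [weight_node, node_eta, factor_of_not_isRed h]

theorem fraction_of_isRed {T : LTree α} (h : T.IsRed) : T.fraction = T.symbol⁻¹ * T.weight := by
  rw [weight_of_isRed h, inv_mul_cancel_left]

theorem subst_factor [DecidableEq β] {f : α → FSymbol β} {z : LTree α} {w : LTree β}
    (hr : w.IsRed ↔ z.IsRed) (h : ∀ y, y ∈ w.labels ↔ ∃ x ∈ z.labels, y ∈ (f x).1) :
    FormalFraction.subst f z.factor = w.factor := by
  by_cases hz : z.IsRed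
  · rw [factor_of_isRed hz, factor_of_isRed (hr.2 hz), subst_symbol h]
  · rw [factor_of_not_isRed hz, factor_of_not_isRed (mt hr.1 hz), map_inv, subst_symbol h]

/-! ### Relabelling -/

theorem isRed_relabel [DecidableEq β] (f : α → β) (T : LTree α) :
    (relabel f T).IsRed ↔ T.IsRed := by
  revert T
  refine ind fun L C ih => ?_
  rw [relabel_node, isRed_node, isRed_node, Finset.image_eq_empty]
  refine and_congr_right fun _ => ?_
  simp only [Multiset.forall_mem_map_iff]
  exact forall₂_congr fun t ht => not_congr (ih t ht)

theorem weight_relabel [DecidableEq β] {f : α → β} (hf : Function.Injective f) (T : LTree α) :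
    weight (relabel f T) = FormalFraction.subst (fun a => FSymbol.singleton (f a)) (weight T) := by
  revert T
  refine ind fun L C ih => ?_
  rw [weight_node, map_mul, subst_factor (isRed_relabel f _) fun y => ?_]
  · rw [relabel_node, weight_node, Multiset.map_map, map_multiset_prod, Multiset.map_map]
    exact congrArg (_ * Multiset.prod ·) (Multiset.map_congr rfl ih)
  · simp only [labels_relabel hf, Multiset.mem_map, FSymbol.mem_singleton, eq_comm]

theorem symbol_relabel [DecidableEq β] {f : α → β} (hf : Function.Injective f) (T : LTree α) :
    symbol (relabel f T) = FormalFraction.subst (fun a => FSymbol.singleton (f a)) (symbol T) :=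
  (subst_symbol fun y => by
    simp only [labels_relabel hf, Multiset.mem_map, FSymbol.mem_singleton, eq_comm]).symm

theorem fraction_relabel [DecidableEq β] {f : α → β} (hf : Function.Injective f) (T : LTree α) :
    fraction (relabel f T) =
      FormalFraction.subst (fun a => FSymbol.singleton (f a)) (fraction T) := by
  by_cases h : T.IsRed
  · rw [fraction_of_isRed h, fraction_of_isRed ((isRed_relabel f T).2 h), map_mul, map_inv,
      weight_relabel hf, symbol_relabel hf]
  · rw [fraction_of_not_isRed h, fraction_of_not_isRed (mt (isRed_relabel f T).1 h),
      weight_relabel hf]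

theorem weight_leaf (x : α) : weight (leaf x) = (symb (FSymbol.singleton x))⁻¹ := by
  rw [leaf, weight_node, Multiset.map_zero, Multiset.prod_zero, mul_one,
    factor_of_not_isRed (not_isRed_of_mem (Finset.mem_singleton_self x)),
    symbol_eq (S := FSymbol.singleton x)]
  intro y
  change _ ↔ y ∈ labels (leaf x)
  rw [labels_leaf, FSymbol.mem_singleton, Multiset.mem_singleton]

theorem not_isRed_leaf (x : α) : ¬ (leaf x).IsRed :=
  not_isRed_of_mem (Finset.mem_singleton_self x)

/-! ### Substitution at a label -/

section Graft

variable [DecidableEq α] {x : α} {S : FSymbol α} {U : LTree α}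

theorem subst_update_weight_of_notMem (T : LTree α) (h : x ∉ labels T) :
    FormalFraction.subst (Function.update FSymbol.singleton x S) (weight T) = weight T := by
  revert T
  refine ind fun L C ih h => ?_
  rw [weight_node, map_mul, subst_factor (z := node L C) Iff.rfl fun y => ?_]
  · rw [map_multiset_prod, Multiset.map_map]
    rw [mem_labels_node, not_or] at h
    exact congrArg (_ * Multiset.prod ·)
      (Multiset.map_congr rfl fun t ht => ih t ht fun hx => h.2 ⟨t, ht, hx⟩)
  · constructor
    · intro hy
      refine ⟨y, hy, ?_⟩
      rw [Function.update_of_ne (fun e : y = x => h (e ▸ hy)), FSymbol.mem_singleton]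
    · rintro ⟨z, hz, hy⟩
      rw [Function.update_of_ne (fun e : z = x => h (e ▸ hz)), FSymbol.mem_singleton] at hy
      exact hy ▸ hz

theorem subst_update_prod_weight_of_notMem (C : Multiset (LTree α)) (h : ∀ t ∈ C, x ∉ labels t) :
    FormalFraction.subst (Function.update FSymbol.singleton x S) (C.map weight).prod =
      (C.map weight).prod := by
  rw [map_multiset_prod, Multiset.map_map]
  exact congrArg Multiset.prod
    (Multiset.map_congr rfl fun t ht => subst_update_weight_of_notMem t (h t ht))

/-- Brings the label count of a graft into the form that `subst_factor` asks for; it serves each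
node on the path from the root to `x`. -/
theorem mem_of_labels_eq_erase_add {z w : LTree α} (hS : ∀ y, y ∈ S.1 ↔ y ∈ U.labels)
    (hnd : (labels z).Nodup) (hx : x ∈ labels z)
    (hw : labels w = (labels z).erase x + labels U) (y : α) :
    y ∈ labels w ↔
      ∃ a ∈ labels z, y ∈ (Function.update FSymbol.singleton x S a : FSymbol α).1 := by
  rw [hw, Multiset.mem_add, hnd.mem_erase_iff]
  constructor
  · rintro (⟨h1, h2⟩ | h)
    · exact ⟨y, h2, by rw [Function.update_of_ne h1, FSymbol.mem_singleton]⟩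
    · exact ⟨x, hx, by rwa [Function.update_self, hS]⟩
  · rintro ⟨a, ha, hy⟩
    by_cases h : a = x
    · subst h
      rw [Function.update_self, hS] at hy
      exact Or.inr hy
    · rw [Function.update_of_ne h, FSymbol.mem_singleton] at hy
      exact Or.inl (hy ▸ ⟨h, ha⟩)

/-- Colour and weight are treated together, since the colour of a node decides the sign of its
exponent. Along the path to `x` the sets change exactly by the substitution, and branches off the
path do not contain `x`. -/
theorem isRed_graftWhite_and_weight (hS : ∀ y, y ∈ S.1 ↔ y ∈ U.labels) (hU : ¬ U.IsRed)
    (T : LTree α) (hnd : (labels T).Nodup) (hx : x ∈ labels T)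
    (hd : ∀ y ∈ labels T, y ≠ x → y ∉ labels U) :
    ((graftWhite x U T).IsRed ↔ T.IsRed) ∧
      weight (graftWhite x U T) = symb S *
        FormalFraction.subst (Function.update FSymbol.singleton x S) (weight T) * weight U := by
  revert T
  refine ind fun L C ih hnd hx hd => ?_
  have hmem := mem_of_labels_eq_erase_add hS hnd hx (labels_graftWhite x U _ hnd hx hd)
  by_cases hL : x ∈ L
  · have hT := not_isRed_of_mem (C := C) hL
    have hT' : ¬ (graftWhite x U (node L C)).IsRed := by
      rw [graftWhite_node, if_pos hL, isRed_node]
      rintro ⟨h1, h2⟩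
      rw [← node_eta U, isRed_node] at hU
      -- If the merged node were red, the root of `U` would have no label and no red child, so `U`
      -- would be red.
      exact hU ⟨(Finset.union_eq_empty.1 h1).2,
        fun t ht => h2 t (Multiset.mem_add.2 (Or.inr ht))⟩
    refine ⟨iff_of_false hT' hT, ?_⟩
    rw [weight_node, map_mul, subst_factor (iff_of_false hT' hT) hmem,
      subst_update_prod_weight_of_notMem C fun t ht => notMem_labels_child hnd hL ht,
      graftWhite_node, if_pos hL, weight_node, Multiset.map_add, Multiset.prod_add]
    -- The root of `U` is no longer a node of its own: its factor `1/[S]` in `weight U` cancels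
    -- against `[S]`.
    conv_rhs => rw [← node_eta U]
    rw [weight_node, node_eta, factor_of_not_isRed hU, symbol_eq hS, mul_comm (symb S),
      mul_assoc (_ * _) (symb S), mul_inv_cancel_left, mul_assoc]
  · obtain ⟨c, D, rfl, hxc, hndc, hD⟩ := exists_child hnd hx hL
    have hcm : c ∈ c ::ₘ D := Multiset.mem_cons_self c D
    obtain ⟨h1, h2⟩ := ih c hcm hndc hxc
      fun y hy hyx => hd y (mem_labels_node.2 (Or.inr ⟨c, hcm, hy⟩)) hyx
    have e : graftWhite x U (node L (c ::ₘ D)) = node L (graftWhite x U c ::ₘ D) := by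
      rw [graftWhite_node, if_neg hL, Multiset.map_cons,
        Multiset.map_congr rfl fun t ht => graftWhite_of_notMem x U t (hD t ht), Multiset.map_id']
    rw [e] at hmem ⊢
    have hr : (node L (graftWhite x U c ::ₘ D)).IsRed ↔ (node L (c ::ₘ D)).IsRed := by
      rw [isRed_node, isRed_node, Multiset.forall_mem_cons, Multiset.forall_mem_cons, h1]
    refine ⟨hr, ?_⟩
    rw [weight_node L (c ::ₘ D), map_mul, subst_factor hr hmem, weight_node, Multiset.map_cons,
      Multiset.map_cons, Multiset.prod_cons, Multiset.prod_cons, map_mul,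
      subst_update_prod_weight_of_notMem D hD, h2]
    ac_rfl

/-- There is no factor `[S]` here, unlike in the white case, because the weight of a red `U` already
contains it as the factor of its root. -/
theorem isRed_graftRed_and_weight (hS : ∀ y, y ∈ S.1 ↔ y ∈ U.labels) (hU : U.IsRed)
    (T : LTree α) (hnd : (labels T).Nodup) (hx : x ∈ labels T) (hne : T ≠ leaf x) :
    ((graftRed x U T).IsRed ↔ T.IsRed) ∧
      weight (graftRed x U T) =
        FormalFraction.subst (Function.update FSymbol.singleton x S) (weight T) * weight U := by
  classical
  revert T
  refine ind fun L C ih hnd hx hne => ?_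
  have hmem := mem_of_labels_eq_erase_add hS hnd hx
    (labels_graftRed x U _ (rootLabels_of_isRed hU) hnd hx)
  by_cases hL : x ∈ L
  · have hT := not_isRed_of_mem (C := C) hL
    have hT' : ¬ (graftRed x U (node L C)).IsRed := by
      rw [graftRed_node, if_pos hL, isRed_node]
      -- Rule (R2): the node may lose its last label but stays white, having gained the red child
      -- `U`.
      exact fun h => h.2 U (Multiset.mem_cons_self U C) hU
    refine ⟨iff_of_false hT' hT, ?_⟩
    rw [weight_node, map_mul, subst_factor (iff_of_false hT' hT) hmem,
      subst_update_prod_weight_of_notMem C fun t ht => notMem_labels_child hnd hL ht,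
      graftRed_node, if_pos hL, weight_node, Multiset.map_cons, Multiset.prod_cons]
    ac_rfl
  · by_cases hl : leaf x ∈ C
    · obtain ⟨D, rfl⟩ := Multiset.exists_cons_of_mem hl
      -- Labels are not repeated, so the child that contains `x` is the leaf itself and the
      -- remaining children avoid `x`.
      have hD : ∀ t ∈ D, x ∉ labels t := by
        obtain ⟨c, D', hc, hxc, -, hD'⟩ := exists_child hnd hx hL
        have hlx : x ∈ labels (leaf x) := by rw [labels_leaf]; exact Multiset.mem_singleton_self x
        have hcl : c = leaf x := by
          have : leaf x ∈ c ::ₘ D' := hc ▸ hl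
          rcases Multiset.mem_cons.1 this with h | h
          · exact h.symm
          · exact absurd hlx (hD' _ h)
        rw [hcl, Multiset.cons_inj_right] at hc
        exact hc ▸ hD'
      have e : graftRed x U (node L (leaf x ::ₘ D)) = node L (D + U.children) := by
        rw [graftRed_node, if_neg hL, if_pos hl, Multiset.erase_cons_head]
      rw [e] at hmem ⊢
      have hU' := hU
      rw [← node_eta U, isRed_node] at hU'
      -- Rule (R3) trades a white leaf for the children of a red root, all white; the colour of the
      -- parent is unaffected.
      have hr : (node L (D + U.children)).IsRed ↔ (node L (leaf x ::ₘ D)).IsRed := by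
        rw [isRed_node, isRed_node, Multiset.forall_mem_cons]
        refine and_congr_right fun _ => ⟨fun h => ⟨not_isRed_leaf x, fun t ht =>
          h t (Multiset.mem_add.2 (Or.inl ht))⟩, fun h t ht => ?_⟩
        rcases Multiset.mem_add.1 ht with h' | h'
        · exact h.2 t h'
        · exact hU'.2 t h'
      refine ⟨hr, ?_⟩
      rw [weight_node L (leaf x ::ₘ D), map_mul, subst_factor hr hmem, weight_node,
        Multiset.map_cons, Multiset.prod_cons, map_mul, subst_update_prod_weight_of_notMem D hD,
        weight_leaf, map_inv, FormalFraction.subst_symb, FSymbol.subst_singleton,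
        Function.update_self, Multiset.map_add, Multiset.prod_add]
      -- Two nodes vanish, and so do their factors: the leaf gives `1/[S]` after substitution and
      -- the root of `U` gives `[S]`.
      conv_rhs => rw [← node_eta U]
      rw [weight_node, node_eta, factor_of_isRed hU, symbol_eq hS, mul_comm (symb S)⁻¹]
      simp only [mul_assoc, mul_comm (symb S)⁻¹]
      rw [mul_comm (symb S), inv_mul_cancel_right]
    · obtain ⟨c, D, rfl, hxc, hndc, hD⟩ := exists_child hnd hx hL
      have hcm : c ∈ c ::ₘ D := Multiset.mem_cons_self c D
      obtain ⟨h1, h2⟩ := ih c hcm hndc hxc fun h => hl (h ▸ hcm)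
      have e : graftRed x U (node L (c ::ₘ D)) = node L (graftRed x U c ::ₘ D) := by
        rw [graftRed_node, if_neg hL, if_neg hl, Multiset.map_cons,
          Multiset.map_congr rfl fun t ht => graftRed_of_notMem x U t (hD t ht), Multiset.map_id']
      rw [e] at hmem ⊢
      have hr : (node L (graftRed x U c ::ₘ D)).IsRed ↔ (node L (c ::ₘ D)).IsRed := by
        rw [isRed_node, isRed_node, Multiset.forall_mem_cons, Multiset.forall_mem_cons, h1]
      refine ⟨hr, ?_⟩
      rw [weight_node L (c ::ₘ D), map_mul, subst_factor hr hmem, weight_node, Multiset.map_cons,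
        Multiset.map_cons, Multiset.prod_cons, Multiset.prod_cons, map_mul,
        subst_update_prod_weight_of_notMem D hD, h2]
      ac_rfl

/-- The rules agree on one formula because the block `[S]` is exactly the gap between `weight U` and
`fraction U` when `U` is red. In case (R1) it cancels the image of `1/[x]`. -/
theorem fraction_graft (hS : ∀ y, y ∈ S.1 ↔ y ∈ U.labels)
    (T : LTree α) (hnd : (labels T).Nodup) (hx : x ∈ labels T)
    (hd : ∀ y ∈ labels T, y ≠ x → y ∉ labels U) :
    fraction (graft T x U) = symb S *
      FormalFraction.subst (Function.update FSymbol.singleton x S) (fraction T) * fraction U := by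
  -- Passage from weights to fractions: the root factor is omitted on both sides or on neither, as
  -- the colours agree, and the two root symbols correspond under substitution.
  have key : ∀ W : LTree α, (W.IsRed ↔ T.IsRed) → labels W = (labels T).erase x + labels U →
      weight W = symb S *
        FormalFraction.subst (Function.update FSymbol.singleton x S) (weight T) * fraction U →
      fraction W = symb S *
        FormalFraction.subst (Function.update FSymbol.singleton x S) (fraction T) *
          fraction U := by
    intro W hr hl hw
    by_cases h : T.IsRed
    · rw [fraction_of_isRed h, fraction_of_isRed (hr.2 h), map_mul, map_inv, hw,
        subst_symbol (mem_of_labels_eq_erase_add hS hnd hx hl)]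
      ac_rfl
    · rw [fraction_of_not_isRed h, fraction_of_not_isRed (mt hr.1 h), hw]
  unfold graft
  split_ifs with h1 h2
  · rw [h2, fraction_of_not_isRed (not_isRed_leaf x), weight_leaf, map_inv,
      FormalFraction.subst_symb, FSymbol.subst_singleton, Function.update_self, mul_inv_cancel,
      one_mul]
  · obtain ⟨hr, hw⟩ := isRed_graftRed_and_weight hS h1 T hnd hx h2
    refine key _ hr (labels_graftRed x U T (rootLabels_of_isRed h1) hnd hx) ?_
    rw [hw, weight_of_isRed h1, symbol_eq hS]
    ac_rfl
  · obtain ⟨hr, hw⟩ := isRed_graftWhite_and_weight hS h1 T hnd hx hd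
    refine key _ hr (labels_graftWhite x U T hnd hx hd) ?_
    rw [hw, fraction_of_not_isRed h1]

end Graft

end LTree

/-! ## Compatibility of `Φ` with the operad structures -/

theorem Phi_act {k : ℕ} (σ : Equiv.Perm (Fin (k + 1))) (T : RWOperad.P k) :
    Phi (RWOperad.act σ T) = FFOperad.act σ (Phi T) :=
  LTree.fraction_relabel σ.injective T.1

theorem Phi_one : Phi RWOperad.one = FFOperad.one :=
  (LTree.fraction_of_not_isRed (LTree.not_isRed_leaf _)).trans (LTree.weight_leaf _)

theorem Phi_comp {k l : ℕ} (T : RWOperad.P k) (i : Fin (k + 1)) (U : RWOperad.P l) :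
    Phi (RWOperad.comp T i U) = FFOperad.comp (Phi T) i (Phi U) := by
  change LTree.fraction ((T.1.relabel (keepIx l i)).graft (keepIx l i i) (U.1.relabel (insIx i))) =
    FormalFraction.comp (LTree.fraction T.1) i (LTree.fraction U.1)
  have hT : ∀ y, y ∈ (T.1.relabel (keepIx l i)).labels ↔ ∃ j, keepIx l i j = y := fun y => by
    rw [LTree.labels_relabel (keepIx_injective l i), T.2.2]
    simp only [Multiset.mem_map, Finset.mem_val, Finset.mem_univ, true_and]
  have hU : ∀ y, y ∈ (U.1.relabel (insIx (k := k) i)).labels ↔ ∃ t, insIx i t = y := fun y => by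
    rw [LTree.labels_relabel (insIx_injective i), U.2.2]
    simp only [Multiset.mem_map, Finset.mem_val, Finset.mem_univ, true_and]
  rw [LTree.fraction_graft (S := blockIx l i)]
  · rw [LTree.fraction_relabel (keepIx_injective l i), LTree.fraction_relabel (insIx_injective i),
      FormalFraction.comp, FormalFraction.subst_subst]
    simp only [FSymbol.subst_singleton]
    -- Renumbering and then replacing the input `i` by the block amounts to substituting slots.
    congr 4
    funext j
    unfold slotIx
    split_ifs with h
    · rw [h, Function.update_self]
    · rw [Function.update_of_ne ((keepIx_injective l i).ne h)]
  · intro y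
    rw [hU, blockIx]
    simp only [Finset.mem_image, Finset.mem_univ, true_and]
  · rw [LTree.labels_relabel (keepIx_injective l i), T.2.2]
    exact Finset.univ.nodup.map (keepIx_injective l i)
  · exact (hT _).2 ⟨i, rfl⟩
  · intro y hy hne hy'
    obtain ⟨j, rfl⟩ := (hT y).1 hy
    obtain ⟨t, ht⟩ := (hU _).1 hy'
    exact keepIx_ne_insIx i j (fun e => hne (by rw [e])) t ht.symm

/-! ## Injectivity of `Φ` -/

/-- The exponent of the symbol `[A]` in a formal fraction. -/
noncomputable def FormalFraction.exponent {α : Type} (A : FSymbol α) (F : FormalFraction α) : ℤ :=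
  Multiplicative.toAdd F A

namespace FormalFraction

variable {α : Type} (A : FSymbol α)

theorem exponent_mul (F G : FormalFraction α) :
    exponent A (F * G) = exponent A F + exponent A G := rfl

theorem exponent_inv (F : FormalFraction α) : exponent A F⁻¹ = - exponent A F := rfl

theorem exponent_symb_self : exponent A (symb A) = 1 := Finsupp.single_eq_same

variable {A}

theorem exponent_symb_of_ne {B : FSymbol α} (h : A ≠ B) : exponent A (symb B) = 0 :=
  Finsupp.single_eq_of_ne h

theorem exponent_prod_eq_zero {M : Multiset (FormalFraction α)} (h : ∀ F ∈ M, exponent A F = 0) :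
    exponent A M.prod = 0 := by
  induction M using Multiset.induction with
  | empty => rfl
  | cons F M ih =>
    rw [Multiset.prod_cons, exponent_mul, h F (Multiset.mem_cons_self F M),
      ih fun G hG => h G (Multiset.mem_cons_of_mem hG), add_zero]

end FormalFraction

namespace LTree

variable {α : Type}

open FormalFraction

/-! ### The family of label sets below the nodes -/

theorem mem_nodes_node {z : LTree α} {L : Finset α} {C : Multiset (LTree α)} :
    z ∈ nodes (node L C) ↔ z = node L C ∨ ∃ t ∈ C, z ∈ nodes t := by
  rw [nodes_node, Multiset.mem_cons]
  exact or_congr_right Multiset.mem_bind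

theorem mem_labels_of_mem_nodes (T : LTree α) {z : LTree α} (hz : z ∈ nodes T) {x : α}
    (hx : x ∈ labels z) : x ∈ labels T := by
  revert T
  refine ind fun L C ih hz => ?_
  rcases mem_nodes_node.1 hz with rfl | ⟨t, ht, hzt⟩
  · exact hx
  · exact mem_labels_node.2 (Or.inr ⟨t, ht, ih t ht hzt⟩)

theorem self_mem_nodes (T : LTree α) : T ∈ nodes T := by
  rw [← node_eta T]
  exact mem_nodes_node.2 (Or.inl rfl)

theorem notMem_labels_of_mem_labels_cons {L : Finset α} {t : LTree α} {D : Multiset (LTree α)}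
    (hnd : (labels (node L (t ::ₘ D))).Nodup) {x : α} (hx : x ∈ labels t) {s : LTree α}
    (hs : s ∈ D) : x ∉ labels s := by
  intro hxs
  rw [labels_node, Multiset.map_cons, Multiset.sum_cons, Multiset.nodup_add, Multiset.nodup_add]
    at hnd
  refine Multiset.disjoint_left.1 hnd.2.1.2.2 hx ?_
  rw [← Multiset.join, Multiset.mem_join]
  exact ⟨_, Multiset.mem_map_of_mem _ hs, hxs⟩

theorem child_eq_of_mem_labels {L : Finset α} {C : Multiset (LTree α)}
    (hnd : (labels (node L C)).Nodup) {s t : LTree α} (hs : s ∈ C) (ht : t ∈ C) {x : α}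
    (hxs : x ∈ labels s) (hxt : x ∈ labels t) : s = t := by
  obtain ⟨D, rfl⟩ := Multiset.exists_cons_of_mem ht
  rcases Multiset.mem_cons.1 hs with h | h
  · exact h
  · exact absurd hxs (notMem_labels_of_mem_labels_cons hnd hxt h)

/-- Two equal children would share a label, as each contains at least one. -/
theorem nodup_children {L : Finset α} {C : Multiset (LTree α)} (hT : (node L C).IsRW)
    (hnd : (labels (node L C)).Nodup) : C.Nodup := by
  rw [isRW_node] at hT
  refine Multiset.nodup_iff_le.2 fun t h => ?_
  obtain ⟨D, rfl⟩ := Multiset.le_iff_exists_add.1 h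
  obtain ⟨x, hx⟩ := exists_mem_labels_of_isRW t (hT.2 t (by simp))
  rw [Multiset.cons_add] at hnd
  exact notMem_labels_of_mem_labels_cons hnd hx (s := t) (by simp) hx

/-- Label sets strictly decrease down the tree: the extra label sits in the root, or in a second
child if the root has none. -/
theorem exists_label_notMem_child {L : Finset α} {C : Multiset (LTree α)} (hT : (node L C).IsRW)
    (hnd : (labels (node L C)).Nodup) {t : LTree α} (ht : t ∈ C) :
    ∃ x ∈ labels (node L C), x ∉ labels t := by
  have hT' := (isRW_node L C).1 hT
  rcases L.eq_empty_or_nonempty with h0 | ⟨x, hx⟩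
  · obtain ⟨D, rfl⟩ := Multiset.exists_cons_of_mem ht
    have h2 := hT'.1 h0
    rw [Multiset.card_cons] at h2
    obtain ⟨s, hs⟩ := Multiset.card_pos_iff_exists_mem.1 (show 0 < D.card by omega)
    obtain ⟨x, hx⟩ := exists_mem_labels_of_isRW s (hT'.2 s (Multiset.mem_cons_of_mem hs))
    exact ⟨x, mem_labels_node.2 (Or.inr ⟨s, Multiset.mem_cons_of_mem hs, hx⟩),
      fun hxt => notMem_labels_of_mem_labels_cons hnd hxt hs hx⟩
  · exact ⟨x, mem_labels_node.2 (Or.inl hx), notMem_labels_child hnd hx ht⟩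

/-- `A` is the set of all labels below some node of `T`. -/
def IsNodeSet (T : LTree α) (A : FSymbol α) : Prop :=
  ∃ z ∈ nodes T, ∀ x, x ∈ A.1 ↔ x ∈ labels z

theorem IsNodeSet.mem_labels {T : LTree α} {A : FSymbol α} (h : T.IsNodeSet A) {x : α}
    (hx : x ∈ A.1) : x ∈ labels T := by
  obtain ⟨z, hz, hA⟩ := h
  exact mem_labels_of_mem_nodes T hz ((hA x).1 hx)

theorem isNodeSet_node {L : Finset α} {C : Multiset (LTree α)} {A : FSymbol α} :
    (node L C).IsNodeSet A ↔
      (∀ x, x ∈ A.1 ↔ x ∈ labels (node L C)) ∨ ∃ t ∈ C, t.IsNodeSet A := by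
  constructor
  · rintro ⟨z, hz, hA⟩
    rcases mem_nodes_node.1 hz with rfl | ⟨t, ht, hzt⟩
    · exact Or.inl hA
    · exact Or.inr ⟨t, ht, z, hzt, hA⟩
  · rintro (hA | ⟨t, ht, z, hzt, hA⟩)
    · exact ⟨_, self_mem_nodes _, hA⟩
    · exact ⟨z, mem_nodes_node.2 (Or.inr ⟨t, ht, hzt⟩), hA⟩

theorem IsRW.exists_symbol {T : LTree α} (h : T.IsRW) :
    ∃ S : FSymbol α, ∀ x, x ∈ S.1 ↔ x ∈ labels T := by
  classical
  obtain ⟨x, hx⟩ := exists_mem_labels_of_isRW T h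
  exact ⟨⟨T.labels.toFinset, x, Multiset.mem_toFinset.2 hx⟩, fun _ => Multiset.mem_toFinset⟩

theorem exponent_symbol_of_ne {T : LTree α} (h : T.IsRW) {A : FSymbol α}
    (hA : ¬ ∀ x, x ∈ A.1 ↔ x ∈ labels T) : exponent A T.symbol = 0 := by
  obtain ⟨S, hS⟩ := h.exists_symbol
  rw [symbol_eq hS, exponent_symb_of_ne]
  rintro rfl
  exact hA hS

theorem exponent_factor_ne_zero_iff {T : LTree α} (h : T.IsRW) {A : FSymbol α} :
    exponent A T.factor ≠ 0 ↔ ∀ x, x ∈ A.1 ↔ x ∈ labels T := by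
  have key : exponent A T.symbol ≠ 0 ↔ ∀ x, x ∈ A.1 ↔ x ∈ labels T := by
    refine ⟨fun h0 => by_contra fun hA => h0 (exponent_symbol_of_ne h hA), fun hA => ?_⟩
    rw [symbol_eq hA, exponent_symb_self]
    exact one_ne_zero
  by_cases hr : T.IsRed
  · rw [factor_of_isRed hr, key]
  · rw [factor_of_not_isRed hr, exponent_inv, neg_ne_zero, key]

/-- No cancellation is possible. The set of the root is too large to occur below it, and a nonempty
set cannot occur in two disjoint children. -/
theorem exponent_weight_ne_zero_iff {T : LTree α} (hT : T.IsRW) (hnd : (labels T).Nodup)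
    {A : FSymbol α} : exponent A T.weight ≠ 0 ↔ T.IsNodeSet A := by
  induction T using ind with | h L C ih => ?_
  have hT' := (isRW_node L C).1 hT
  have ih' : ∀ t ∈ C, ¬ t.IsNodeSet A → exponent A t.weight = 0 := fun t ht h =>
    by_contra fun h0 => h ((ih t ht (hT'.2 t ht) (nodup_labels_child hnd ht)).1 h0)
  rw [weight_node, exponent_mul, isNodeSet_node]
  by_cases hA : ∀ x, x ∈ A.1 ↔ x ∈ labels (node L C)
  · have h0 : exponent A (C.map weight).prod = 0 := by
      refine exponent_prod_eq_zero fun F hF => ?_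
      obtain ⟨t, ht, rfl⟩ := Multiset.mem_map.1 hF
      obtain ⟨x, hx, hxt⟩ := exists_label_notMem_child hT hnd ht
      exact ih' t ht fun h => hxt (h.mem_labels ((hA x).2 hx))
    rw [h0, add_zero]
    exact iff_of_true ((exponent_factor_ne_zero_iff hT).2 hA) (Or.inl hA)
  · rw [not_not.1 (mt (exponent_factor_ne_zero_iff hT).1 hA), zero_add, or_iff_right hA]
    by_cases h : ∃ t ∈ C, t.IsNodeSet A
    · refine iff_of_true ?_ h
      obtain ⟨t, ht, h⟩ := h
      have h1 := (ih t ht (hT'.2 t ht) (nodup_labels_child hnd ht)).2 h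
      obtain ⟨D, rfl⟩ := Multiset.exists_cons_of_mem ht
      rwa [Multiset.map_cons, Multiset.prod_cons, exponent_mul, exponent_prod_eq_zero, add_zero]
      intro F hF
      obtain ⟨s, hs, rfl⟩ := Multiset.mem_map.1 hF
      refine ih' s (Multiset.mem_cons_of_mem hs) fun h' => ?_
      obtain ⟨x, hx⟩ := A.2
      exact notMem_labels_of_mem_labels_cons hnd (h.mem_labels hx) hs (h'.mem_labels hx)
    · refine iff_of_false (not_not.2 (exponent_prod_eq_zero fun F hF => ?_)) h
      obtain ⟨t, ht, rfl⟩ := Multiset.mem_map.1 hF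
      exact ih' t ht fun h' => h ⟨t, ht, h'⟩

/-- Recovers the family of a child from that of the tree, which is what an induction over families
needs. The root set does not fit into the child, and a set from another child would be disjoint from
it. -/
theorem isNodeSet_child_iff {L : Finset α} {C : Multiset (LTree α)} (hT : (node L C).IsRW)
    (hnd : (labels (node L C)).Nodup) {t : LTree α} (ht : t ∈ C) {A : FSymbol α} :
    t.IsNodeSet A ↔ (node L C).IsNodeSet A ∧ ∀ x ∈ A.1, x ∈ labels t := by
  rw [isNodeSet_node]
  refine ⟨fun h => ⟨Or.inr ⟨t, ht, h⟩, fun x hx => h.mem_labels hx⟩, ?_⟩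
  rintro ⟨hA | ⟨s, hs, h⟩, hAt⟩
  · obtain ⟨x, hx, hxt⟩ := exists_label_notMem_child hT hnd ht
    exact absurd (hAt x ((hA x).2 hx)) hxt
  · obtain ⟨x, hx⟩ := A.2
    rwa [child_eq_of_mem_labels hnd ht hs (hAt x hx) (h.mem_labels hx)]

theorem labels_subset_of_isNodeSet {T T' : LTree α} (hT : T.IsRW)
    (h : ∀ A, T.IsNodeSet A → T'.IsNodeSet A) {x : α} (hx : x ∈ labels T) : x ∈ labels T' := by
  obtain ⟨S, hS⟩ := hT.exists_symbol
  exact (h S ⟨T, self_mem_nodes T, hS⟩).mem_labels ((hS x).2 hx)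

theorem exists_child_labels_subset {L L' : Finset α} {C C' : Multiset (LTree α)}
    (hT : (node L C).IsRW) (hnd : (labels (node L C)).Nodup)
    (hl : ∀ x ∈ labels (node L C), x ∈ labels (node L' C'))
    (h : ∀ A, (node L C).IsNodeSet A → (node L' C').IsNodeSet A) {t : LTree α} (ht : t ∈ C) :
    ∃ s ∈ C', ∀ x ∈ labels t, x ∈ labels s := by
  obtain ⟨S, hS⟩ := ((isRW_node L C).1 hT |>.2 t ht).exists_symbol
  have h1 := h S (isNodeSet_node.2 (Or.inr ⟨t, ht, t, self_mem_nodes t, hS⟩))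
  rcases isNodeSet_node.1 h1 with h2 | ⟨s, hs, h2⟩
  · obtain ⟨x, hx, hxt⟩ := exists_label_notMem_child hT hnd ht
    exact absurd ((hS x).1 ((h2 x).2 (hl x hx))) hxt
  · exact ⟨s, hs, fun x hx => h2.mem_labels ((hS x).2 hx)⟩

theorem mem_rootLabels_iff {L : Finset α} {C : Multiset (LTree α)}
    (hnd : (labels (node L C)).Nodup) {x : α} :
    x ∈ L ↔ x ∈ labels (node L C) ∧ ∀ t ∈ C, x ∉ labels t := by
  refine ⟨fun h => ⟨mem_labels_node.2 (Or.inl h), fun t ht => notMem_labels_child hnd h ht⟩, ?_⟩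
  rintro ⟨h, h'⟩
  rcases mem_labels_node.1 h with h | ⟨t, ht, hx⟩
  · exact h
  · exact absurd hx (h' t ht)

/-- A tree is determined by the sets of labels below its nodes. -/
theorem eq_of_isNodeSet_iff {T : LTree α} (hT : T.IsRW) (hnd : (labels T).Nodup) {T' : LTree α}
    (hT' : T'.IsRW) (hnd' : (labels T').Nodup) (h : ∀ A, T.IsNodeSet A ↔ T'.IsNodeSet A) :
    T = T' := by
  induction T using ind generalizing T' with | h L C ih => ?_
  revert hT' hnd' h
  rw [← node_eta T']
  generalize T'.rootLabels = L'
  generalize T'.children = C'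
  intro hT' hnd' h
  have hl : ∀ x, x ∈ labels (node L C) ↔ x ∈ labels (node L' C') := fun x =>
    ⟨labels_subset_of_isNodeSet hT fun A => (h A).1,
      labels_subset_of_isNodeSet hT' fun A => (h A).2⟩
  have h1 : ∀ t ∈ C', ∃ s ∈ C, ∀ x ∈ labels t, x ∈ labels s := fun t ht =>
    exists_child_labels_subset hT' hnd' (fun x => (hl x).2) (fun A => (h A).2) ht
  -- The children carry the maximal proper sets of the family. Going from `t` to a child `s` of the
  -- other tree and back to `r` gives inclusions from `t` to `r`; siblings with a common label
  -- coincide, so `r` is `t` and `s` has the same labels.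
  have key : ∀ t ∈ C, t ∈ C' := by
    intro t ht
    obtain ⟨s, hs, hts⟩ :=
      exists_child_labels_subset hT hnd (fun x => (hl x).1) (fun A => (h A).1) ht
    obtain ⟨r, hr, hsr⟩ := h1 s hs
    have htRW := (isRW_node L C).1 hT |>.2 t ht
    obtain ⟨x, hx⟩ := exists_mem_labels_of_isRW t htRW
    obtain rfl := child_eq_of_mem_labels hnd ht hr hx (hsr x (hts x hx))
    have hls : ∀ x, x ∈ labels t ↔ x ∈ labels s := fun x => ⟨hts x, hsr x⟩
    rw [ih t ht htRW (nodup_labels_child hnd ht) ((isRW_node L' C').1 hT' |>.2 s hs)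
      (nodup_labels_child hnd' hs) fun A => ?_]
    · exact hs
    · rw [isNodeSet_child_iff hT hnd ht, isNodeSet_child_iff hT' hnd' hs, h]
      simp only [hls]
  have hC : C = C' := by
    refine (Multiset.Nodup.ext (nodup_children hT hnd) (nodup_children hT' hnd')).2 fun t =>
      ⟨key t, fun ht => ?_⟩
    obtain ⟨s, hs, hts⟩ := h1 t ht
    obtain ⟨x, hx⟩ := exists_mem_labels_of_isRW t ((isRW_node L' C').1 hT' |>.2 t ht)
    rwa [child_eq_of_mem_labels hnd' ht (key s hs) hx (hts x hx)]
  subst hC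
  congr 1
  ext x
  rw [mem_rootLabels_iff hnd, mem_rootLabels_iff hnd', hl]

theorem exponent_fraction_of_ne {T : LTree α} (hT : T.IsRW) {A : FSymbol α}
    (hA : ¬ ∀ x, x ∈ A.1 ↔ x ∈ labels T) : exponent A T.fraction = exponent A T.weight := by
  by_cases h : T.IsRed
  · rw [fraction_of_isRed h, exponent_mul, exponent_inv, exponent_symbol_of_ne hT hA, neg_zero,
      zero_add]
  · rw [fraction_of_not_isRed h]

/-- The fraction may hide the factor of a red root, but the full set of labels is a node set of both
trees in any case. All other exponents are those of the weight. -/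
theorem eq_of_fraction_eq {T T' : LTree α} (hT : T.IsRW) (hT' : T'.IsRW)
    (hnd : (labels T).Nodup) (hl : labels T = labels T') (h : T.fraction = T'.fraction) :
    T = T' := by
  have hnd' : (labels T').Nodup := hl ▸ hnd
  refine eq_of_isNodeSet_iff hT hnd hT' hnd' fun A => ?_
  by_cases hA : ∀ x, x ∈ A.1 ↔ x ∈ labels T
  · exact iff_of_true ⟨T, self_mem_nodes T, hA⟩ ⟨T', self_mem_nodes T', hl ▸ hA⟩
  · rw [← exponent_weight_ne_zero_iff hT hnd, ← exponent_weight_ne_zero_iff hT' hnd',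
      ← exponent_fraction_of_ne hT hA, ← exponent_fraction_of_ne hT' (hl ▸ hA), h]

end LTree

theorem Phi_injective {k : ℕ} : Function.Injective (Phi (k := k)) := fun T T' h =>
  Subtype.ext (LTree.eq_of_fraction_eq T.2.1 T'.2.1
    (Eq.subst (motive := Multiset.Nodup) T.2.2.symm Finset.univ.nodup) (T.2.2.trans T'.2.2.symm) h)

/-! ## The operad of labelled red and white trees -/

theorem heq_of_Phi_heq {m n : ℕ} (h : m = n) {T : RWOperad.P m} {T' : RWOperad.P n}
    (e : HEq (Phi T) (Phi T')) : HEq T T' := by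
  subst h
  exact heq_of_eq (Phi_injective (eq_of_heq e))

/-- No case analysis on trees is needed: `Φ` is injective and compatible with all operations, so
each axiom is pulled back from fractions. -/
theorem isSymmOperad_RWOperad : IsSymmOperad RWOperad where
  assoc {k l p} A B C i j := by
    refine heq_of_Phi_heq (Nat.add_assoc k l p) ?_
    simp only [Phi_comp]
    exact isSymmOperad_FFOperad.assoc _ _ _ i j
  comm {k l p} A B C i j hij := by
    refine heq_of_Phi_heq (Nat.add_right_comm k l p) ?_
    simp only [Phi_comp]
    exact isSymmOperad_FFOperad.comm _ _ _ i j hij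
  one_comp {k} A := by
    refine heq_of_Phi_heq (Nat.zero_add k) ?_
    rw [Phi_comp, Phi_one]
    exact isSymmOperad_FFOperad.one_comp _
  comp_one A i := by
    refine Phi_injective ?_
    have := Phi_comp A i RWOperad.one
    rw [Phi_one, isSymmOperad_FFOperad.comp_one] at this
    exact this
  act_one A := Phi_injective (by rw [Phi_act, isSymmOperad_FFOperad.act_one])
  act_mul σ τ A := Phi_injective (by
    rw [Phi_act, Phi_act, Phi_act, isSymmOperad_FFOperad.act_mul])
  comp_act σ τ A B i := Phi_injective (by
    rw [Phi_act, Phi_comp, Phi_comp, Phi_act, Phi_act, isSymmOperad_FFOperad.comp_act])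

/-! ## Fractions generated by the three generators, over any alphabet -/

/-- `F` is a generated fraction of the operad, the inputs of which are renamed so that they are
the elements of `A`. -/
def IsGenFraction {α : Type} [DecidableEq α] (A : FSymbol α) (F : FormalFraction α) : Prop :=
  ∃ (k : ℕ) (e : Fin (k + 1) → α) (F₀ : FormalFraction (Fin (k + 1))), Function.Injective e ∧
    (∀ y, y ∈ A.1 ↔ ∃ j, e j = y) ∧ FFOperad.Gen ffGenerators k F₀ ∧
      F = FormalFraction.subst (fun j => FSymbol.singleton (e j)) F₀

/-- The union of two symbols. -/
def FSymbol.union {α : Type} [DecidableEq α] (A B : FSymbol α) : FSymbol α :=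
  ⟨A.1 ∪ B.1, A.2.mono Finset.subset_union_left⟩

/-- The symbol `{a, b}`. -/
def FSymbol.pair {α : Type} [DecidableEq α] (a b : α) : FSymbol α :=
  ⟨{a, b}, Finset.insert_nonempty a {b}⟩

theorem FSymbol.mem_union {α : Type} [DecidableEq α] {A B : FSymbol α} {y : α} :
    y ∈ (A.union B).1 ↔ y ∈ A.1 ∨ y ∈ B.1 := Finset.mem_union

theorem FSymbol.mem_pair {α : Type} [DecidableEq α] {a b y : α} :
    y ∈ (FSymbol.pair a b).1 ↔ y = a ∨ y = b := by
  simp [FSymbol.pair]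

theorem FSymbol.subst_update_of_notMem {α : Type} [DecidableEq α] {b : α} {A B : FSymbol α}
    (h : b ∉ A.1) : FSymbol.subst (Function.update FSymbol.singleton b B) A = A := by
  conv_rhs => rw [← FSymbol.subst_id A]
  exact FSymbol.subst_congr fun a ha =>
    Function.update_of_ne (fun e : a = b => h (e ▸ ha)) _ _

theorem FSymbol.subst_update_of_mem {α : Type} [DecidableEq α] {b : α} {A B C : FSymbol α}
    (h : b ∈ A.1) (hC : ∀ y, y ∈ C.1 ↔ (y ∈ A.1 ∧ y ≠ b) ∨ y ∈ B.1) :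
    FSymbol.subst (Function.update FSymbol.singleton b B) A = C := by
  refine FSymbol.ext_mem fun y => ?_
  rw [FSymbol.mem_subst, hC]
  constructor
  · rintro ⟨a, ha, hy⟩
    by_cases hab : a = b
    · rw [hab, Function.update_self] at hy
      exact Or.inr hy
    · rw [Function.update_of_ne hab, FSymbol.mem_singleton] at hy
      exact Or.inl (hy ▸ ⟨ha, hab⟩)
  · rintro (⟨h1, h2⟩ | hy)
    · exact ⟨y, h1, by rw [Function.update_of_ne h2, FSymbol.mem_singleton]⟩
    · exact ⟨b, h, by rwa [Function.update_self]⟩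

namespace IsGenFraction

variable {α : Type} [DecidableEq α] {A B C : FSymbol α} {F G : FormalFraction α}

theorem subst_update_of_notMem (hF : IsGenFraction A F) {b : α} (h : b ∉ A.1) :
    FormalFraction.subst (Function.update FSymbol.singleton b B) F = F := by
  obtain ⟨k, e, F₀, he, hA, hG, rfl⟩ := hF
  rw [FormalFraction.subst_subst]
  congr 2
  funext j
  rw [FSymbol.subst_singleton, Function.update_of_ne]
  rintro rfl
  exact h ((hA _).2 ⟨j, rfl⟩)

/-- Composition without renumbering: letters keep their names, and only disjointness is required. -/
theorem comp (hF : IsGenFraction A F) (hG : IsGenFraction B G) {x : α} (hx : x ∈ A.1)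
    (hd : ∀ y ∈ A.1, y ≠ x → y ∉ B.1) (hC : ∀ y, y ∈ C.1 ↔ (y ∈ A.1 ∧ y ≠ x) ∨ y ∈ B.1) :
    IsGenFraction C
      (symb B * FormalFraction.subst (Function.update FSymbol.singleton x B) F * G) := by
  obtain ⟨k, e, F₀, he, hA, hF₀, rfl⟩ := hF
  obtain ⟨l, e', G₀, he', hB, hG₀, rfl⟩ := hG
  obtain ⟨i, rfl⟩ := (hA x).1 hx
  -- The enumeration of `C` follows `e` outside the block and `e'` inside it.
  let f : Fin (k + l + 1) → α := fun y => Sum.elim (fun j => e j.1) e' ((splitIx k l i).symm y)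
  have f1 : ∀ j, j ≠ i → f (keepIx l i j) = e j := fun j hj => by
    have : (splitIx k l i).symm (keepIx l i j) = Sum.inl ⟨j, hj⟩ :=
      (Equiv.symm_apply_eq _).2 rfl
    simp only [f, this, Sum.elim_inl]
  have f2 : ∀ t, f (insIx i t) = e' t := fun t => by
    have : (splitIx k l i).symm (insIx i t) = Sum.inr t := (Equiv.symm_apply_eq _).2 rfl
    simp only [f, this, Sum.elim_inr]
  have hdis : ∀ j, j ≠ i → ∀ t, e j ≠ e' t := fun j hj t h =>
    hd (e j) ((hA _).2 ⟨j, rfl⟩) (he.ne hj) ((hB _).2 ⟨t, h.symm⟩)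
  have hblock : FSymbol.subst (fun j => FSymbol.singleton (f j)) (blockIx l i) = B := by
    refine FSymbol.ext_mem fun y => ?_
    rw [FSymbol.mem_subst, hB, blockIx]
    simp only [Finset.mem_image, Finset.mem_univ, true_and, FSymbol.mem_singleton]
    constructor
    · rintro ⟨_, ⟨t, rfl⟩, rfl⟩
      exact ⟨t, (f2 t).symm⟩
    · rintro ⟨t, rfl⟩
      exact ⟨_, ⟨t, rfl⟩, (f2 t).symm⟩
  have hgen : FFOperad.Gen ffGenerators (k + l) (FormalFraction.comp F₀ i G₀) :=
    SymmOperadData.Gen.comp (O := FFOperad) F₀ i G₀ hF₀ hG₀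
  refine ⟨k + l, f, FormalFraction.comp F₀ i G₀, ?_, ?_, hgen, ?_⟩
  · intro a b hab
    rcases keepIx_or_insIx i a with ⟨j, hj, rfl⟩ | ⟨t, rfl⟩ <;>
      rcases keepIx_or_insIx i b with ⟨j', hj', rfl⟩ | ⟨t', rfl⟩
    · rw [f1 j hj, f1 j' hj'] at hab
      rw [he hab]
    · rw [f1 j hj, f2] at hab
      exact absurd hab (hdis j hj t')
    · rw [f1 j' hj', f2] at hab
      exact absurd hab.symm (hdis j' hj' t)
    · rw [f2, f2] at hab
      rw [he' hab]
  · intro y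
    rw [hC, hA, hB]
    constructor
    · rintro (⟨⟨j, rfl⟩, hne⟩ | ⟨t, rfl⟩)
      · exact ⟨_, f1 j fun h => hne (h ▸ rfl)⟩
      · exact ⟨_, f2 t⟩
    · rintro ⟨a, rfl⟩
      rcases keepIx_or_insIx i a with ⟨j, hj, rfl⟩ | ⟨t, rfl⟩
      · exact Or.inl (f1 j hj ▸ ⟨⟨j, rfl⟩, he.ne hj⟩)
      · exact Or.inr ⟨t, (f2 t).symm⟩
  · rw [FormalFraction.comp, map_mul, map_mul, FormalFraction.subst_symb, hblock,
      FormalFraction.subst_subst, FormalFraction.subst_subst, FormalFraction.subst_subst]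
    simp only [FSymbol.subst_singleton, f2]
    congr 4
    funext j
    unfold slotIx
    split_ifs with h
    · rw [h, Function.update_self, hblock]
    · rw [Function.update_of_ne (he.ne h), FSymbol.subst_singleton, f1 j h]

/-! ### The unit and the generators on arbitrary letters -/

theorem singleton (a : α) :
    IsGenFraction (FSymbol.singleton a) (symb (FSymbol.singleton a))⁻¹ := by
  refine ⟨0, fun _ => a, (symb (FSymbol.singleton 0))⁻¹, fun _ _ _ => Subsingleton.elim (α := Fin 1) _ _,
    fun y => ?_, .one, ?_⟩
  · rw [FSymbol.mem_singleton, exists_const, eq_comm]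
  · rw [map_inv, FormalFraction.subst_symb, FSymbol.subst_singleton]

theorem of_generator {a b : α} (hab : a ≠ b) {F₀ : FormalFraction (Fin 2)}
    (h : F₀ ∈ (ffGenerators 1 : Set (FormalFraction (Fin 2)))) :
    IsGenFraction (FSymbol.pair a b)
      (FormalFraction.subst (fun j => FSymbol.singleton ((![a, b] : Fin 2 → α) j)) F₀) := by
  refine ⟨1, ![a, b], F₀, ?_, fun y => ?_, SymmOperadData.Gen.basic (O := FFOperad) (k := 1) F₀ h, rfl⟩
  · intro i j
    fin_cases i <;> fin_cases j <;> simp [hab, hab.symm]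
  · rw [FSymbol.mem_pair, Fin.exists_fin_two, eq_comm, eq_comm (a := y)]
    rfl

theorem subst_pair_zero (a b : α) (h : ({0} : Finset (Fin 2)).Nonempty) :
    FSymbol.subst (fun j => FSymbol.singleton ((![a, b] : Fin 2 → α) j)) ⟨{0}, h⟩ =
      FSymbol.singleton a :=
  FSymbol.ext_mem fun y => by simp [FSymbol.mem_subst, FSymbol.mem_singleton]

theorem subst_pair_one (a b : α) (h : ({1} : Finset (Fin 2)).Nonempty) :
    FSymbol.subst (fun j => FSymbol.singleton ((![a, b] : Fin 2 → α) j)) ⟨{1}, h⟩ =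
      FSymbol.singleton b :=
  FSymbol.ext_mem fun y => by simp [FSymbol.mem_subst, FSymbol.mem_singleton]

theorem subst_pair_both (a b : α) (h : ({0, 1} : Finset (Fin 2)).Nonempty) :
    FSymbol.subst (fun j => FSymbol.singleton ((![a, b] : Fin 2 → α) j)) ⟨{0, 1}, h⟩ =
      FSymbol.pair a b :=
  FSymbol.ext_mem fun y => by simp [FSymbol.mem_subst, FSymbol.mem_singleton, FSymbol.mem_pair]

theorem pair_chain {a b : α} (hab : a ≠ b) : IsGenFraction (FSymbol.pair a b)
    (symb (FSymbol.singleton a) * symb (FSymbol.pair a b))⁻¹ := by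
  convert of_generator hab (Or.inl rfl) using 1
  rw [map_inv, map_mul, FormalFraction.subst_symb, FormalFraction.subst_symb, subst_pair_zero,
    subst_pair_both]

theorem pair_node {a b : α} (hab : a ≠ b) : IsGenFraction (FSymbol.pair a b)
    (symb (FSymbol.pair a b))⁻¹ := by
  convert of_generator hab (Or.inr (Or.inl rfl)) using 1
  rw [map_inv, FormalFraction.subst_symb, subst_pair_both]

theorem pair_red {a b : α} (hab : a ≠ b) : IsGenFraction (FSymbol.pair a b)
    (symb (FSymbol.singleton a) * symb (FSymbol.singleton b))⁻¹ := by
  convert of_generator hab (Or.inr (Or.inr rfl)) using 1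
  rw [map_inv, map_mul, FormalFraction.subst_symb, FormalFraction.subst_symb, subst_pair_zero,
    subst_pair_one]

/-- Substitution of two disjoint fractions into a fraction with two inputs. -/
theorem comp_pair {a b : α} (hab : a ≠ b) {P : FormalFraction α}
    (hP : IsGenFraction (FSymbol.pair a b) P) (hF : IsGenFraction A F) (hG : IsGenFraction B G)
    (hb : b ∈ B.1) (hd : ∀ y ∈ A.1, y ∉ B.1) :
    IsGenFraction (A.union B)
      (symb B * (symb A * FormalFraction.subst (Function.update FSymbol.singleton b B)
        (FormalFraction.subst (Function.update FSymbol.singleton a A) P) * F) * G) := by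
  have hbA : b ∉ A.1 := fun h => hd b h hb
  -- Since `b` lies in `B`, it is outside `A` and remains a free input after the first substitution.
  have h1 : IsGenFraction (A.union (FSymbol.singleton b))
      (symb A * FormalFraction.subst (Function.update FSymbol.singleton a A) P * F) := by
    refine hP.comp hF (FSymbol.mem_pair.2 (Or.inl rfl)) (fun y hy hya => ?_) fun y => ?_
    · rcases FSymbol.mem_pair.1 hy with h | h
      · exact absurd h hya
      · exact h ▸ hbA
    · rw [FSymbol.mem_union, FSymbol.mem_pair, FSymbol.mem_singleton]
      constructor
      · rintro (h | rfl)
        · exact Or.inr h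
        · exact Or.inl ⟨Or.inr rfl, hab.symm⟩
      · rintro (⟨h | h, h'⟩ | h)
        · exact absurd h h'
        · exact Or.inr h
        · exact Or.inl h
  have h2 := h1.comp (C := A.union B) hG (x := b)
    (FSymbol.mem_union.2 (Or.inr (FSymbol.mem_singleton.2 rfl))) (fun y hy hyb => ?_) fun y => ?_
  · rwa [map_mul, map_mul, hF.subst_update_of_notMem hbA, FormalFraction.subst_symb,
      FSymbol.subst_update_of_notMem hbA] at h2
  · rw [FSymbol.mem_union, FSymbol.mem_singleton, or_iff_left hyb] at hy
    exact hd y hy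
  · rw [FSymbol.mem_union, FSymbol.mem_union, FSymbol.mem_singleton]
    constructor
    · rintro (h | h)
      · exact Or.inl ⟨Or.inl h, fun e => hbA (e ▸ h)⟩
      · exact Or.inr h
    · rintro (⟨h | h, h'⟩ | h)
      · exact Or.inl h
      · exact absurd h h'
      · exact Or.inr h

/-! ### Three products of fractions with disjoint inputs -/

theorem subst_subst_pair {a b : α} (ha : a ∈ A.1) (hb : b ∈ B.1) :
    FSymbol.subst (Function.update FSymbol.singleton b B)
    (FSymbol.subst (Function.update FSymbol.singleton a A) (FSymbol.pair a b)) = A.union B := by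
  have h1 : FSymbol.subst (Function.update FSymbol.singleton a A) (FSymbol.pair a b) =
      A.union (FSymbol.singleton b) :=
    FSymbol.subst_update_of_mem (FSymbol.mem_pair.2 (Or.inl rfl)) fun y => by
      rw [FSymbol.mem_union, FSymbol.mem_pair, FSymbol.mem_singleton]
      by_cases h : y = a
      · simp [h, ha]
      · simp [h, or_comm]
  rw [h1]
  refine FSymbol.subst_update_of_mem
    (FSymbol.mem_union.2 (Or.inr (FSymbol.mem_singleton.2 rfl))) fun y => ?_
  rw [FSymbol.mem_union, FSymbol.mem_union, FSymbol.mem_singleton]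
  by_cases h : y = b
  · simp [h, hb]
  · simp [h]

theorem subst_subst_left {a b : α} (hb : b ∈ B.1) (hd : ∀ y ∈ A.1, y ∉ B.1) :
    FSymbol.subst (Function.update FSymbol.singleton b B)
    (FSymbol.subst (Function.update FSymbol.singleton a A) (FSymbol.singleton a)) = A := by
  rw [FSymbol.subst_singleton, Function.update_self,
    FSymbol.subst_update_of_notMem fun h => hd b h hb]

theorem subst_subst_right {a b : α} (ha : a ∈ A.1) (hb : b ∈ B.1) (hd : ∀ y ∈ A.1, y ∉ B.1) :
    FSymbol.subst (Function.update FSymbol.singleton b B)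
    (FSymbol.subst (Function.update FSymbol.singleton a A) (FSymbol.singleton b)) = B := by
  have hba : b ≠ a := fun e => hd b (e ▸ ha) hb
  rw [FSymbol.subst_singleton, Function.update_of_ne hba, FSymbol.subst_singleton,
    Function.update_self]

/-- The generator `1/([a][b])` becomes `1/([A][B])` and cancels both correcting factors. -/
theorem mul (hF : IsGenFraction A F) (hG : IsGenFraction B G) (hd : ∀ y ∈ A.1, y ∉ B.1) :
    IsGenFraction (A.union B) (F * G) := by
  obtain ⟨a, ha⟩ := A.2
  obtain ⟨b, hb⟩ := B.2
  have hab : a ≠ b := fun e => hd a ha (e ▸ hb)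
  convert comp_pair hab (pair_red hab) hF hG hb hd using 1
  rw [map_inv, map_mul, FormalFraction.subst_symb, FormalFraction.subst_symb, map_inv, map_mul,
    FormalFraction.subst_symb, FormalFraction.subst_symb, subst_subst_left hb hd,
    subst_subst_right ha hb hd, mul_inv, mul_assoc (symb A), mul_assoc (_)⁻¹,
    mul_inv_cancel_left, mul_assoc, mul_assoc, mul_inv_cancel_left]

/-- Comes from `1/[ab]`. The factors `[B]` and `G` are kept together because they form the weight
when `G` is the fraction of a red child. -/
theorem mul_node (hF : IsGenFraction A F) (hG : IsGenFraction B G) (hd : ∀ y ∈ A.1, y ∉ B.1) :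
    IsGenFraction (A.union B) (symb A * (symb (A.union B))⁻¹ * F * (symb B * G)) := by
  obtain ⟨a, ha⟩ := A.2
  obtain ⟨b, hb⟩ := B.2
  have hab : a ≠ b := fun e => hd a ha (e ▸ hb)
  convert comp_pair hab (pair_node hab) hF hG hb hd using 1
  rw [map_inv, FormalFraction.subst_symb, map_inv, FormalFraction.subst_symb,
    subst_subst_pair ha hb]
  ac_rfl

/-- Comes from `1/([b][ab])`, the first generator with its inputs exchanged; the image `1/[B]`
cancels the factor `[B]`. -/
theorem mul_chain (hF : IsGenFraction A F) (hG : IsGenFraction B G) (hd : ∀ y ∈ A.1, y ∉ B.1) :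
    IsGenFraction (A.union B) (symb A * (symb (A.union B))⁻¹ * F * G) := by
  obtain ⟨a, ha⟩ := A.2
  obtain ⟨b, hb⟩ := B.2
  have hab : a ≠ b := fun e => hd a ha (e ▸ hb)
  have hpair : FSymbol.pair b a = FSymbol.pair a b :=
    FSymbol.ext_mem fun y => by rw [FSymbol.mem_pair, FSymbol.mem_pair, or_comm]
  have hP := pair_chain hab.symm
  rw [hpair] at hP
  convert comp_pair hab hP hF hG hb hd using 1
  rw [map_inv, map_mul, FormalFraction.subst_symb, FormalFraction.subst_symb, map_inv, map_mul,
    FormalFraction.subst_symb, FormalFraction.subst_symb, subst_subst_pair ha hb,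
    subst_subst_right ha hb hd, mul_inv, mul_left_comm (symb A), mul_assoc (_)⁻¹,
    mul_inv_cancel_left]

/-- Labels are added to a single node one at a time: in `mul_node`, the fractions `1/[A]` and
`1/[a]` cancel both correcting factors. -/
theorem inv_symb (A : FSymbol α) : IsGenFraction A (symb A)⁻¹ := by
  obtain ⟨A, hA⟩ := A
  induction hA using Finset.Nonempty.cons_induction with
  | singleton a => exact singleton a
  | cons a s ha hs ih =>
    have h := mul_node ih (singleton a) fun y hy hya => ha (FSymbol.mem_singleton.1 hya ▸ hy)
    have e : FSymbol.union ⟨s, hs⟩ (FSymbol.singleton a) =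
        ⟨Finset.cons a s ha, Finset.cons_nonempty ha⟩ :=
      FSymbol.ext_mem fun y => by
        rw [FSymbol.mem_union, FSymbol.mem_singleton, Finset.mem_cons, or_comm]
    rw [e, mul_inv_cancel, mul_one, mul_right_comm, mul_inv_cancel, one_mul] at h
    exact h

end IsGenFraction

/-! ## Every tree gives a generated fraction -/

namespace LTree

theorem val_add_nodup_of_cons {α : Type} {S : FSymbol α} {c : LTree α} {L : Finset α}
    {D : Multiset (LTree α)} (hS : ∀ x, x ∈ S.1 ↔ x ∈ labels c)
    (hnd : (labels (node L (c ::ₘ D))).Nodup) : (S.1.val + (D.map labels).sum).Nodup := by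
  rw [labels_node, Multiset.map_cons, Multiset.sum_cons, Multiset.nodup_add] at hnd
  have h := hnd.2.1
  have e : S.1.val = labels c :=
    (Multiset.Nodup.ext S.1.nodup (Multiset.nodup_add.1 h).1).2 fun x => hS x
  rwa [e]

variable {α : Type} [DecidableEq α]

/-- Attaches one child to a white node under construction, by `mul_node` or `mul_chain` according to
the colour of the child. -/
theorem isGenFraction_mul_weight {A S : FSymbol α} {F : FormalFraction α} {t : LTree α}
    (hF : IsGenFraction A F) (ht : IsGenFraction S t.fraction)
    (hS : ∀ x, x ∈ S.1 ↔ x ∈ labels t) (hd : ∀ y ∈ A.1, y ∉ S.1) :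
    IsGenFraction (A.union S) (symb A * (symb (A.union S))⁻¹ * F * t.weight) := by
  by_cases h : t.IsRed
  · rw [weight_of_isRed h, symbol_eq hS]
    exact hF.mul_node ht hd
  · rw [← fraction_of_not_isRed h]
    exact hF.mul_chain ht hd

theorem nodup_union_add {A S : FSymbol α} {M : Multiset α} {t : LTree α}
    (hS : ∀ x, x ∈ S.1 ↔ x ∈ labels t) (hnd : (A.1.val + (labels t + M)).Nodup) :
    (∀ y ∈ A.1, y ∉ S.1) ∧ ((A.union S).1.val + M).Nodup := by
  rw [← add_assoc, Multiset.nodup_add, Multiset.nodup_add, Multiset.disjoint_left,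
    Multiset.disjoint_left] at hnd
  refine ⟨fun y hy hyS => hnd.1.2.2 hy ((hS y).1 hyS), Multiset.nodup_add.2
    ⟨(A.union S).1.nodup, hnd.2.1, Multiset.disjoint_left.2 fun {y} hy => hnd.2.2 ?_⟩⟩
  exact Multiset.mem_add.2 ((FSymbol.mem_union.1 hy).imp id (hS y).1)

/-- Children are attached one by one. The factors `[A]/[A ∪ S]` telescope, so only the first and the
last set remain. -/
theorem isGenFraction_prod_weight (C : Multiset (LTree α)) :
    ∀ {A B : FSymbol α} {F : FormalFraction α}, IsGenFraction A F →
      (∀ t ∈ C, ∃ S : FSymbol α, (∀ x, x ∈ S.1 ↔ x ∈ labels t) ∧ IsGenFraction S t.fraction) →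
      (A.1.val + (C.map labels).sum).Nodup →
      (∀ x, x ∈ B.1 ↔ x ∈ A.1 ∨ ∃ t ∈ C, x ∈ labels t) →
      IsGenFraction B (symb A * (symb B)⁻¹ * F * (C.map weight).prod) := by
  induction C using Multiset.induction with
  | empty =>
    intro A B F hF _ _ hB
    obtain rfl : B = A := FSymbol.ext_mem fun x => by simp [hB x]
    rwa [mul_inv_cancel, one_mul, Multiset.map_zero, Multiset.prod_zero, mul_one]
  | cons t D ih =>
    intro A B F hF hC hnd hB
    obtain ⟨S, hS, ht⟩ := hC t (Multiset.mem_cons_self t D)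
    rw [Multiset.map_cons, Multiset.sum_cons] at hnd
    obtain ⟨hd, hnd'⟩ := nodup_union_add hS hnd
    have h := ih (B := B) (isGenFraction_mul_weight hF ht hS hd)
      (fun s hs => hC s (Multiset.mem_cons_of_mem hs)) hnd' fun x => by
        rw [hB, FSymbol.mem_union, hS, or_assoc]
        simp
    convert h using 1
    rw [Multiset.map_cons, Multiset.prod_cons]
    calc _ = symb (A.union S) * (symb (A.union S))⁻¹ *
          (symb A * (symb B)⁻¹ * F * (t.weight * (D.map weight).prod)) := by
          rw [mul_inv_cancel, one_mul]
      _ = _ := by ac_rfl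

theorem isGenFraction_prod_weight_of_not_isRed (C : Multiset (LTree α)) :
    ∀ {A B : FSymbol α} {F : FormalFraction α}, IsGenFraction A F →
      (∀ t ∈ C, ∃ S : FSymbol α, (∀ x, x ∈ S.1 ↔ x ∈ labels t) ∧ IsGenFraction S t.fraction) →
      (∀ t ∈ C, ¬ t.IsRed) → (A.1.val + (C.map labels).sum).Nodup →
      (∀ x, x ∈ B.1 ↔ x ∈ A.1 ∨ ∃ t ∈ C, x ∈ labels t) →
      IsGenFraction B (F * (C.map weight).prod) := by
  induction C using Multiset.induction with
  | empty =>
    intro A B F hF _ _ _ hB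
    obtain rfl : B = A := FSymbol.ext_mem fun x => by simp [hB x]
    rwa [Multiset.map_zero, Multiset.prod_zero, mul_one]
  | cons t D ih =>
    intro A B F hF hC hr hnd hB
    obtain ⟨S, hS, ht⟩ := hC t (Multiset.mem_cons_self t D)
    rw [Multiset.map_cons, Multiset.sum_cons] at hnd
    obtain ⟨hd, hnd'⟩ := nodup_union_add hS hnd
    rw [Multiset.map_cons, Multiset.prod_cons, ← mul_assoc,
      ← fraction_of_not_isRed (hr t (Multiset.mem_cons_self t D))]
    exact ih (hF.mul ht hd) (fun s hs => hC s (Multiset.mem_cons_of_mem hs))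
      (fun s hs => hr s (Multiset.mem_cons_of_mem hs)) hnd' fun x => by
        rw [hB, FSymbol.mem_union, hS, or_assoc]
        simp

theorem isGenFraction_fraction (T : LTree α) (hT : T.IsRW) (hnd : (labels T).Nodup)
    {S : FSymbol α} (hS : ∀ x, x ∈ S.1 ↔ x ∈ labels T) : IsGenFraction S T.fraction := by
  induction T using ind generalizing S with | h L C ih => ?_
  have hT' := (isRW_node L C).1 hT
  have hC : ∀ t ∈ C, ∃ S : FSymbol α,
      (∀ x, x ∈ S.1 ↔ x ∈ labels t) ∧ IsGenFraction S t.fraction := fun t ht => by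
    obtain ⟨S, hS⟩ := (hT'.2 t ht).exists_symbol
    exact ⟨S, hS, ih t ht (hT'.2 t ht) (nodup_labels_child hnd ht) hS⟩
  have hS' : ∀ x, x ∈ S.1 ↔ x ∈ L ∨ ∃ t ∈ C, x ∈ labels t := fun x => by
    rw [hS, mem_labels_node]
  by_cases hr : (node L C).IsRed
  · have hr' := (isRed_node L C).1 hr
    -- A red root contributes no factor and its children are white, so the fraction is a plain
    -- product of theirs; one child starts the product.
    obtain ⟨c, hc⟩ :=
      Multiset.card_pos_iff_exists_mem.1 (lt_of_lt_of_le two_pos (hT'.1 hr'.1))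
    obtain ⟨D, rfl⟩ := Multiset.exists_cons_of_mem hc
    obtain ⟨R, hR, hcR⟩ := hC c hc
    have h := isGenFraction_prod_weight_of_not_isRed (B := S) D hcR
      (fun t ht => hC t (Multiset.mem_cons_of_mem ht))
      (fun t ht => hr'.2 t (Multiset.mem_cons_of_mem ht)) (val_add_nodup_of_cons hR hnd)
      fun x => by
        rw [hS', hR, hr'.1]
        simp
    rw [fraction_eq_prod, if_pos hr, one_mul, children_node, Multiset.map_cons,
      Multiset.prod_cons, ← fraction_of_not_isRed (hr'.2 c hc)]
    exact h
  · rw [fraction_eq_prod, if_neg hr, children_node, symbol_eq hS]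
    rcases L.eq_empty_or_nonempty with h0 | h0
    · obtain ⟨c, hc, hcr⟩ : ∃ c ∈ C, c.IsRed := by
        by_contra! h
        exact hr ((isRed_node L C).2 ⟨h0, h⟩)
      obtain ⟨D, rfl⟩ := Multiset.exists_cons_of_mem hc
      obtain ⟨R, hR, hcR⟩ := hC c hc
      have h := isGenFraction_prod_weight (B := S) D hcR
        (fun t ht => hC t (Multiset.mem_cons_of_mem ht)) (val_add_nodup_of_cons hR hnd)
        fun x => by
          rw [hS', hR, h0]
          simp
      convert h using 1
      rw [Multiset.map_cons, Multiset.prod_cons, weight_of_isRed hcr, symbol_eq hR]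
      ac_rfl
    -- Starting from `1/[L]`, the telescoped factor `[L]/[S]` leaves the root factor `1/[S]`.
    · have h := isGenFraction_prod_weight (B := S) C (IsGenFraction.inv_symb ⟨L, h0⟩) hC
        (labels_node L C ▸ hnd) hS'
      rwa [mul_right_comm (symb _), mul_inv_cancel, one_mul] at h

end LTree

/-- When every input is used, the enumeration is a permutation, so the action of the symmetric group
removes the renaming. -/
theorem IsGenFraction.gen {k : ℕ} {A : FSymbol (Fin (k + 1))} {F : FormalFraction (Fin (k + 1))}
    (h : IsGenFraction A F) (hA : ∀ x, x ∈ A.1) : FFOperad.Gen ffGenerators k F := by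
  obtain ⟨m, e, F₀, he, hAe, hF₀, rfl⟩ := h
  have hb : Function.Bijective e := ⟨he, fun y => (hAe y).1 (hA y)⟩
  have hm : m = k := by
    have := Fintype.card_of_bijective hb
    simpa using this
  subst hm
  exact SymmOperadData.Gen.act (O := FFOperad) (Equiv.ofBijective e hb) F₀ hF₀

theorem gen_Phi {k : ℕ} (T : RWOperad.P k) : FFOperad.Gen ffGenerators k (Phi T) := by
  refine IsGenFraction.gen (A := ⟨Finset.univ, Finset.univ_nonempty⟩) ?_ Finset.mem_univ
  refine LTree.isGenFraction_fraction T.1 T.2.1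
    (Eq.subst (motive := Multiset.Nodup) T.2.2.symm Finset.univ.nodup) fun x => ?_
  have h : T.1.labels = Finset.univ.val := T.2.2
  rw [h]
  exact Iff.rfl

/-! ## Every generated fraction comes from a tree -/

theorem LTree.symbol_node_zero {α : Type} (L : Finset α) (h : L.Nonempty) :
    (LTree.node L 0).symbol = symb ⟨L, h⟩ :=
  LTree.symbol_eq fun x => by rw [LTree.mem_labels_node]; simp

theorem exists_Phi_eq_of_mem_ffGenerators {k : ℕ} {F : FFOperad.P k} (h : F ∈ ffGenerators k) :
    ∃ T, Phi T = F := by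
  match k, F, h with
  | 1, F, h =>
    rcases h with rfl | rfl | rfl
    -- Inputs count from `0`: the symbol `[1]` has to come from the leaf, so the root carries the
    -- second input.
    · refine ⟨⟨LTree.node {1} {LTree.leaf 0}, ?_, ?_⟩, ?_⟩
      · rw [LTree.isRW_node]
        simp [LTree.leaf, LTree.isRW_node]
      · rw [LTree.labels_node, Multiset.map_singleton, Multiset.sum_singleton, LTree.labels_leaf]
        decide
      · refine (LTree.fraction_of_not_isRed
          (LTree.not_isRed_of_mem (Finset.mem_singleton_self _))).trans ?_
        rw [LTree.weight_node, LTree.factor_of_not_isRed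
          (LTree.not_isRed_of_mem (Finset.mem_singleton_self _)), Multiset.map_singleton,
          Multiset.prod_singleton, LTree.weight_leaf, mul_inv]
        rw [LTree.symbol_eq (S := ⟨{0, 1}, by simp⟩)]
        · exact mul_comm _ _
        · intro x
          rw [LTree.mem_labels_node]
          simp [LTree.labels_leaf, or_comm]
    · refine ⟨⟨LTree.node {0, 1} 0, ?_, ?_⟩, ?_⟩
      · rw [LTree.isRW_node]
        simp
      · rw [LTree.labels_node]
        decide
      · have h0 : (0 : Fin 2) ∈ ({0, 1} : Finset (Fin 2)) := by simp
        refine (LTree.fraction_of_not_isRed (LTree.not_isRed_of_mem h0)).trans ?_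
        rw [LTree.weight_node, LTree.factor_of_not_isRed (LTree.not_isRed_of_mem h0),
          LTree.symbol_node_zero _ ⟨0, h0⟩]
        exact mul_one _
    · refine ⟨⟨LTree.node ∅ {LTree.leaf 0, LTree.leaf 1}, ?_, ?_⟩, ?_⟩
      · rw [LTree.isRW_node]
        simp [LTree.leaf, LTree.isRW_node]
      · rw [LTree.labels_node]
        simp only [Multiset.insert_eq_cons, Multiset.map_cons, Multiset.map_singleton,
          Multiset.sum_cons, Multiset.sum_singleton, LTree.labels_leaf]
        decide
      · have hr : (LTree.node (∅ : Finset (Fin 2)) {LTree.leaf 0, LTree.leaf 1}).IsRed := by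
          rw [LTree.isRed_node]
          simp [LTree.not_isRed_leaf]
        refine (LTree.fraction_eq_prod _).trans ?_
        rw [if_pos hr, LTree.children_node, one_mul, Multiset.insert_eq_cons, Multiset.map_cons,
          Multiset.map_singleton, Multiset.prod_cons, Multiset.prod_singleton, LTree.weight_leaf,
          LTree.weight_leaf, mul_inv]
        rfl
  | 0, _, h => exact absurd h (Set.notMem_empty _)
  | _ + 2, _, h => exact absurd h (Set.notMem_empty _)

theorem exists_Phi_eq_of_gen {k : ℕ} {F : FFOperad.P k} (h : FFOperad.Gen ffGenerators k F) :
    ∃ T, Phi T = F := by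
  induction h with
  | basic A h => exact exists_Phi_eq_of_mem_ffGenerators h
  | one => exact ⟨RWOperad.one, Phi_one⟩
  | comp A i B _ _ hA hB =>
    obtain ⟨T, rfl⟩ := hA
    obtain ⟨U, rfl⟩ := hB
    exact ⟨RWOperad.comp T i U, Phi_comp T i U⟩
  | act σ A _ hA =>
    obtain ⟨T, rfl⟩ := hA
    exact ⟨RWOperad.act σ T, Phi_act σ T⟩

/-- The isomorphism induced by `Φ`. -/
noncomputable def phiIso : SymmOperadIso RWOperad (FFOperad.generatedBy ffGenerators) where
  equiv k := Equiv.ofBijective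
    (fun T => (⟨Phi T, gen_Phi T⟩ : {F : FFOperad.P k // FFOperad.Gen ffGenerators k F}))
    ⟨fun _ _ h => Phi_injective (congrArg Subtype.val h), fun F => by
      obtain ⟨T, hT⟩ := exists_Phi_eq_of_gen F.2
      exact ⟨T, Subtype.ext hT⟩⟩
  map_one := Subtype.ext Phi_one
  map_comp A i B := Subtype.ext (Phi_comp A i B)
  map_act σ A := Subtype.ext (Phi_act σ A)

theorem mainTheorem5 :
    IsSymmOperad RWOperad ∧ IsSymmOperad FFOperad ∧
      ∃ e : SymmOperadIso RWOperad (FFOperad.generatedBy ffGenerators),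
        ∀ (k : ℕ) (T : RWOperad.P k), (e.equiv k T).1 = Phi T := by
  exact ⟨isSymmOperad_RWOperad, isSymmOperad_FFOperad, phiIso, fun _ _ => rfl⟩
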